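/- Let $G$ be a compact Lie group of even dimension $n$ with Lie algebra $\mathfrak g$; in particular $G$ may be any compact even-dimensional semisimple Lie group. Conventions. A complex structure on a smooth manifold $M$ is a smooth endomorphism field $J$ of $TM$ with $J^2=-1$ and vanishing Nijenhuis tensor. A Riemannian metric $g$ is Hermitian (compatible with $J$) if $g(JX,JY)=g(X,Y)$; put $\omega(X,Y)=g(X,JY)$. The Bismut connection of $(J,g)$ is the connection $\nabla^B$ with $\nabla^BJ=0$, $\nabla^Bg=0$ whose torsion $c(X,Y,Z)=g(X,T^B(Y,Z))$ is totally skew-symmetric. A Hermitian metric $g$ is SKT if $dc=0$. With $R^B(X,Y)Z=\nabla^B_{[X,Y]}Z-[\nabla^B_X,\nabla^B_Y]Z$ and a local orthonormal frame $(e_k)$, the Ricci form is $\rho^B(X,Y)=\frac12\sum_k g(R^B(X,Y)e_k,Je_k)$, and its $(1,1)$-part is $(\rho^B)^{1,1}(X,Y)=\frac12\big(\rho^B(X,Y)+\rho^B(JX,JY)\big)$. The metric $g$ is static with constant $\lambda\in\mathbb R$ if it is SKT and $-(\rho^B)^{1,1}=\lambda\,\omega$. A left-invariant complex structure $J$ on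 $G$ is called Samelson if on $\mathfrak g$ it commutes with $\mathrm{ad}\,h$ for every $h$ in some maximal abelian subalgebra of $\mathfrak g$. Then: 1. $G$ admits a complex structure together with a static metric with $\lambda=0$. 2. $G$ admits a bi-invariant (left- and right-invariant) Riemannian metric. If $\mathfrak g$ is semisimple, the negative of the Killing form of $\mathfrak g$ induces a bi-invariant Riemannian metric on $G$. 3. Every bi-invariant Riemannian metric on $G$ is compatible with some Samelson left-invariant complex structure on $G$. 4. Let $g$ be a bi-invariant Riemannian metric on $G$ and $J$ a left-invariant complex structure compatible with $g$. Then the Bismut connection $\nabla^B$ of $(J,g)$ exists, and every connection with its defining properties satisfies $\nabla^B_XY=0$ for all left-invariant vector fields $X,Y$, $dc=0$, and $\rho^B=0$. Hence $g$ is SKT, and it is static with $\lambda=0$. -/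

import Mathlib

open Bundle VectorField
open scoped Manifold ContDiff Topology

/-- A smooth real Lie group has the regularity that Mathlib requires for its Lie algebra. -/
instance instLieGroupMinSmoothnessThree {n : ℕ} {G : Type*} [TopologicalSpace G]
    [ChartedSpace (EuclideanSpace ℝ (Fin n)) G] [Group G] [LieGroup (𝓡 n) ∞ G] :
    LieGroup (𝓡 n) (minSmoothness ℝ 3) G :=
  LieGroup.of_le (n := ∞) (by
    rw [minSmoothness_of_isRCLikeNormedField]
    exact ENat.LEInfty.out)

noncomputable section

namespace HermitianGeometry

section Manifold

variable {n : ℕ} {M : Type*} [TopologicalSpace M] [ChartedSpace (EuclideanSpace ℝ (Fin n)) M]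
  [IsManifold (𝓡 n) ∞ M]

/-- The vector field `X` is smooth near the point `x`. -/
def SmoothFieldAt (X : ∀ x : M, TangentSpace (𝓡 n) x) (x : M) : Prop :=
  ContMDiffAt (𝓡 n) (𝓡 n).tangent ∞ (fun y ↦ (⟨y, X y⟩ : TangentBundle (𝓡 n) M)) x

variable (n M) in
/-- A complex structure on the smooth manifold `M`: a smooth field `J` of endomorphisms of the
tangent spaces with `J² = -1` and vanishing Nijenhuis tensor. -/
structure ComplexStructure where
  /-- The endomorphism of each tangent space. -/
  J : ∀ x : M, TangentSpace (𝓡 n) x →L[ℝ] TangentSpace (𝓡 n) x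
  contMDiff_J : ContMDiff (𝓡 n)
    ((𝓡 n).prod 𝓘(ℝ, EuclideanSpace ℝ (Fin n) →L[ℝ] EuclideanSpace ℝ (Fin n))) ∞
    (fun x ↦ TotalSpace.mk' (EuclideanSpace ℝ (Fin n) →L[ℝ] EuclideanSpace ℝ (Fin n))
      (E := fun x : M ↦ TangentSpace (𝓡 n) x →L[ℝ] TangentSpace (𝓡 n) x) x (J x))
  J_J : ∀ (x : M) (v : TangentSpace (𝓡 n) x), J x (J x v) = -v
  nijenhuis_eq_zero : ∀ (x : M) (X Y : ∀ y : M, TangentSpace (𝓡 n) y),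
    SmoothFieldAt X x → SmoothFieldAt Y x →
      mlieBracket (𝓡 n) (fun y ↦ J y (X y)) (fun y ↦ J y (Y y)) x
        - J x (mlieBracket (𝓡 n) (fun y ↦ J y (X y)) Y x)
        - J x (mlieBracket (𝓡 n) X (fun y ↦ J y (Y y)) x)
        - mlieBracket (𝓡 n) X Y x = 0

variable (n M) in
/-- Smooth Riemannian metrics on `M`. -/
abbrev Metric : Type _ :=
  ContMDiffRiemannianMetric (𝓡 n) ∞ (EuclideanSpace ℝ (Fin n))
    (fun x : M ↦ TangentSpace (𝓡 n) x)

variable (n M) in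
/-- Affine connections on `M`. The expression `D Y x (X x)` is `(∇_X Y)(x)`. -/
abbrev Connection : Type _ :=
  CovariantDerivative (𝓡 n) (EuclideanSpace ℝ (Fin n)) (fun x : M ↦ TangentSpace (𝓡 n) x)

/-- The metric `g` is Hermitian with respect to (compatible with) `J`. -/
def IsHermitian (C : ComplexStructure n M) (g : Metric n M) : Prop :=
  ∀ (x : M) (v w : TangentSpace (𝓡 n) x), g.inner x (C.J x v) (C.J x w) = g.inner x v w

/-- The fundamental form `ω(v, w) = g(v, J w)`. -/
def fundamentalForm (C : ComplexStructure n M) (g : Metric n M) (x : M)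
    (v w : TangentSpace (𝓡 n) x) : ℝ :=
  g.inner x v (C.J x w)

/-- The torsion `c(u, v, w) = g(u, T(v, w))` of a connection, all indices lowered. -/
def torsionForm (g : Metric n M) (D : Connection n M) (x : M)
    (u v w : TangentSpace (𝓡 n) x) : ℝ :=
  g.inner x u (D.torsion x v w)

/-- `D` is the Bismut connection of `(J, g)`: a smooth connection with `∇J = 0` and `∇g = 0` whose
torsion `c` is totally skew-symmetric. -/
structure IsBismut (C : ComplexStructure n M) (g : Metric n M) (D : Connection n M) : Prop where
  smooth : D.ContMDiffCovariantDerivative ∞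
  parallel_J : ∀ (x : M) (Y : ∀ y : M, TangentSpace (𝓡 n) y), SmoothFieldAt Y x →
    ∀ v : TangentSpace (𝓡 n) x, D (fun y ↦ C.J y (Y y)) x v = C.J x (D Y x v)
  parallel_metric : ∀ (x : M) (Y Z : ∀ y : M, TangentSpace (𝓡 n) y),
    SmoothFieldAt Y x → SmoothFieldAt Z x → ∀ v : TangentSpace (𝓡 n) x,
      mvfderiv (𝓡 n) (fun y ↦ g.inner y (Y y) (Z y)) x v
        = g.inner x (D Y x v) (Z x) + g.inner x (Y x) (D Z x v)
  skew_left : ∀ (x : M) (u v w : TangentSpace (𝓡 n) x),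
    torsionForm g D x u v w = -torsionForm g D x v u w
  skew_right : ∀ (x : M) (u v w : TangentSpace (𝓡 n) x),
    torsionForm g D x u v w = -torsionForm g D x u w v

/-- The exterior derivative of a field `c` of trilinear alternating forms, evaluated at `x` on four
vector fields by the invariant formula. -/
def extDerivThree
    (c : ∀ x : M, TangentSpace (𝓡 n) x → TangentSpace (𝓡 n) x → TangentSpace (𝓡 n) x → ℝ)
    (X₀ X₁ X₂ X₃ : ∀ x : M, TangentSpace (𝓡 n) x) (x : M) : ℝ :=
  mvfderiv (𝓡 n) (fun y ↦ c y (X₁ y) (X₂ y) (X₃ y)) x (X₀ x)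
    - mvfderiv (𝓡 n) (fun y ↦ c y (X₀ y) (X₂ y) (X₃ y)) x (X₁ x)
    + mvfderiv (𝓡 n) (fun y ↦ c y (X₀ y) (X₁ y) (X₃ y)) x (X₂ x)
    - mvfderiv (𝓡 n) (fun y ↦ c y (X₀ y) (X₁ y) (X₂ y)) x (X₃ x)
    - c x (mlieBracket (𝓡 n) X₀ X₁ x) (X₂ x) (X₃ x)
    + c x (mlieBracket (𝓡 n) X₀ X₂ x) (X₁ x) (X₃ x)
    - c x (mlieBracket (𝓡 n) X₀ X₃ x) (X₁ x) (X₂ x)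
    - c x (mlieBracket (𝓡 n) X₁ X₂ x) (X₀ x) (X₃ x)
    + c x (mlieBracket (𝓡 n) X₁ X₃ x) (X₀ x) (X₂ x)
    - c x (mlieBracket (𝓡 n) X₂ X₃ x) (X₀ x) (X₁ x)

/-- The torsion form `c` of `D` is closed: `dc = 0`. -/
def HasClosedTorsion (g : Metric n M) (D : Connection n M) : Prop :=
  ∀ (x : M) (X₀ X₁ X₂ X₃ : ∀ y : M, TangentSpace (𝓡 n) y),
    SmoothFieldAt X₀ x → SmoothFieldAt X₁ x → SmoothFieldAt X₂ x → SmoothFieldAt X₃ x →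
      extDerivThree (torsionForm g D) X₀ X₁ X₂ X₃ x = 0

/-- The curvature `R(X, Y)Z = ∇_{[X, Y]} Z - [∇_X, ∇_Y] Z` (with this sign). -/
def curvature (D : Connection n M) (X Y Z : ∀ x : M, TangentSpace (𝓡 n) x) (x : M) :
    TangentSpace (𝓡 n) x :=
  D Z x (mlieBracket (𝓡 n) X Y x)
    - (D (fun y ↦ D Z y (Y y)) x (X x) - D (fun y ↦ D Z y (X y)) x (Y x))

/-- The fields `e₁, …, eₙ` form a smooth orthonormal frame of the tangent bundle near `x`. -/
def IsOrthonormalFrameAt (g : Metric n M) (e : Fin n → ∀ x : M, TangentSpace (𝓡 n) x)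
    (x : M) : Prop :=
  (∀ i, SmoothFieldAt (e i) x) ∧
    ∀ᶠ y in 𝓝 x, ∀ i j, g.inner y (e i y) (e j y) = if i = j then 1 else 0

/-- The Ricci form `ρ(X, Y) = ½ ∑ₖ g(R(X, Y) eₖ, J eₖ)`, computed in the frame `e`. -/
def ricciForm (C : ComplexStructure n M) (g : Metric n M) (D : Connection n M)
    (e : Fin n → ∀ x : M, TangentSpace (𝓡 n) x) (X Y : ∀ x : M, TangentSpace (𝓡 n) x)
    (x : M) : ℝ :=
  (1 / 2) * ∑ k, g.inner x (curvature D X Y (e k) x) (C.J x (e k x))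

/-- The `(1,1)`-part `½ (ρ(X, Y) + ρ(JX, JY))` of the Ricci form. -/
def ricciFormOneOne (C : ComplexStructure n M) (g : Metric n M) (D : Connection n M)
    (e : Fin n → ∀ x : M, TangentSpace (𝓡 n) x) (X Y : ∀ x : M, TangentSpace (𝓡 n) x)
    (x : M) : ℝ :=
  (1 / 2) * (ricciForm C g D e X Y x
    + ricciForm C g D e (fun y ↦ C.J y (X y)) (fun y ↦ C.J y (Y y)) x)

/-- The Ricci form of `D` vanishes identically. -/
def RicciFormVanishes (C : ComplexStructure n M) (g : Metric n M) (D : Connection n M) : Prop :=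
  ∀ (x : M) (e : Fin n → ∀ y : M, TangentSpace (𝓡 n) y) (X Y : ∀ y : M, TangentSpace (𝓡 n) y),
    IsOrthonormalFrameAt g e x → SmoothFieldAt X x → SmoothFieldAt Y x →
      ricciForm C g D e X Y x = 0

/-- `g` is an SKT metric on `(M, J)`: it is Hermitian and the torsion form of its Bismut connection
is closed. -/
def IsSKT (C : ComplexStructure n M) (g : Metric n M) : Prop :=
  IsHermitian C g ∧ ∃ D : Connection n M, IsBismut C g D ∧ HasClosedTorsion g D

/-- `g` is a static metric on `(M, J)` with constant `l`: it is SKT and the Ricci form of its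
Bismut connection satisfies `-ρ^{1,1} = l ω`. -/
def IsStatic (C : ComplexStructure n M) (g : Metric n M) (l : ℝ) : Prop :=
  IsSKT C g ∧ ∃ D : Connection n M, IsBismut C g D ∧
    ∀ (x : M) (e : Fin n → ∀ y : M, TangentSpace (𝓡 n) y) (X Y : ∀ y : M, TangentSpace (𝓡 n) y),
      IsOrthonormalFrameAt g e x → SmoothFieldAt X x → SmoothFieldAt Y x →
        -ricciFormOneOne C g D e X Y x = l * fundamentalForm C g x (X x) (Y x)

end Manifold

section Group

variable {n : ℕ} {G : Type*} [TopologicalSpace G] [ChartedSpace (EuclideanSpace ℝ (Fin n)) G]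
  [Group G] [LieGroup (𝓡 n) ∞ G]

/-- The metric `g` is invariant under all left translations and all right translations. -/
def IsBiinvariant (g : Metric n G) : Prop :=
  (∀ (a x : G) (v w : TangentSpace (𝓡 n) x),
    g.inner (a * x) (mfderiv (𝓡 n) (𝓡 n) (fun y ↦ a * y) x v)
      (mfderiv (𝓡 n) (𝓡 n) (fun y ↦ a * y) x w) = g.inner x v w) ∧
  (∀ (a x : G) (v w : TangentSpace (𝓡 n) x),
    g.inner (x * a) (mfderiv (𝓡 n) (𝓡 n) (fun y ↦ y * a) x v)
      (mfderiv (𝓡 n) (𝓡 n) (fun y ↦ y * a) x w) = g.inner x v w)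

/-- On the Lie algebra, `g` is minus the Killing form. -/
def IsInducedByKillingForm (g : Metric n G) : Prop :=
  ∀ v w : GroupLieAlgebra (𝓡 n) G,
    g.inner 1 v w = -killingForm ℝ (GroupLieAlgebra (𝓡 n) G) v w

/-- The complex structure `J` is invariant under all left translations. -/
def IsLeftInvariant (C : ComplexStructure n G) : Prop :=
  ∀ (a x : G) (v : TangentSpace (𝓡 n) x),
    C.J (a * x) (mfderiv (𝓡 n) (𝓡 n) (fun y ↦ a * y) x v)
      = mfderiv (𝓡 n) (𝓡 n) (fun y ↦ a * y) x (C.J x v)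

/-- `J` is a Samelson complex structure: it is left-invariant, and on the Lie algebra it commutes
with `ad h` for all `h` in some maximal abelian subalgebra `t`. When `G` is compact, this says that
the space of `(1,0)`-vectors is the sum of a subspace of `t ⊗ ℂ` and of root spaces with respect to
`t`; by integrability the roots that occur are a system of positive roots. -/
def IsSamelson (C : ComplexStructure n G) : Prop :=
  IsLeftInvariant C ∧ ∃ t : LieSubalgebra ℝ (GroupLieAlgebra (𝓡 n) G),
    IsLieAbelian t ∧
    (∀ t' : LieSubalgebra ℝ (GroupLieAlgebra (𝓡 n) G), IsLieAbelian t' → t ≤ t' → t' = t) ∧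
    ∀ h ∈ t, ∀ v : GroupLieAlgebra (𝓡 n) G,
      (C.J 1 ⁅h, v⁆ : GroupLieAlgebra (𝓡 n) G) = ⁅h, (C.J 1 v : GroupLieAlgebra (𝓡 n) G)⁆

/-- The covariant derivatives of left-invariant fields along left-invariant fields vanish. -/
def VanishesOnLeftInvariant (D : Connection n G) : Prop :=
  ∀ (u v : GroupLieAlgebra (𝓡 n) G) (x : G),
    D (mulInvariantVectorField v) x (mulInvariantVectorField u x) = 0

end Group

end HermitianGeometry

end

set_option linter.unusedSectionVars false

noncomputable section

namespace HermitianGeometry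

variable {n : ℕ} {G : Type*} [TopologicalSpace G] [ChartedSpace (EuclideanSpace ℝ (Fin n)) G]
  [Group G] [LieGroup (𝓡 n) ∞ G]

/-! Left translations trivialize the tangent bundle, and vector fields become functions with values
in the Lie algebra. In these coordinates a bi-invariant metric `g` and a left-invariant `J` are
constant, so both are parallel for the flat connection that differentiates coordinates. Its torsion
on left-invariant fields is `-[u, v]`, whence `c(u, v, w) = -g(u, [v, w])`. This form is alternating
because bi-invariance makes every `ad u` skew (`lieBr_skew_of_coAd`), so the flat connection is a
Bismut connection (`isBismut_flatConnection`). Any other one differs from it by a tensor that is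
alternating and changes sign when `J` moves from one slot to another; such a tensor is zero
(`eq_zero_of_skew_of_complex`). Flatness kills the curvature and with it the Ricci form, and `dc =
0` is the Jacobi identity.

A bi-invariant metric comes from averaging an inner product over Haar measure
(`exists_invariant_inner`). For this inner product `ad v` is skew, so the trace of its square is
negative unless `v` is central; in the semisimple case minus the Killing form is therefore positive
definite.

For a Samelson structure, choose `h` whose centralizer `t` is abelian, and put `A = ad h`, a skew
map. On the eigenspace of `-A²` for `a² > 0` set `J = A / a`; on `t = ker A`, whose dimension has
the parity of `n`, take any orthogonal complex structure. This amounts to choosing positive roots by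
their sign on `h`. Integrability (`exists_samelson`) holds because a sum of positive roots is
positive on `h`. -/

/-! ### Translations, invariant frames and the adjoint action -/

theorem mdifferentiableAt_leftMul (a x : G) :
    MDifferentiableAt (𝓡 n) (𝓡 n) (fun y : G ↦ a * y) x :=
  (contMDiff_mul_left (I := 𝓡 n) (n := ∞)).contMDiffAt.mdifferentiableAt (by simp)

theorem mdifferentiableAt_rightMul (a x : G) :
    MDifferentiableAt (𝓡 n) (𝓡 n) (fun y : G ↦ y * a) x :=
  (contMDiff_mul_right (I := 𝓡 n) (n := ∞)).contMDiffAt.mdifferentiableAt (by simp)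

/-- The left-invariant frame at `x`: the derivative at `1` of left translation by `x`. -/
def leftFrame (x : G) : EuclideanSpace ℝ (Fin n) →L[ℝ] TangentSpace (𝓡 n) x :=
  mfderiv (𝓡 n) (𝓡 n) (fun y : G ↦ x * y) 1

/-- The right-invariant frame at `x`: the derivative at `1` of right translation by `x`. -/
def rightFrame (x : G) : EuclideanSpace ℝ (Fin n) →L[ℝ] TangentSpace (𝓡 n) x :=
  mfderiv (𝓡 n) (𝓡 n) (fun y : G ↦ y * x) 1

/-- The left trivialization of the tangent bundle (the Maurer–Cartan form). -/
def leftTriv (x : G) : TangentSpace (𝓡 n) x →L[ℝ] EuclideanSpace ℝ (Fin n) :=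
  mfderiv (𝓡 n) (𝓡 n) (fun y : G ↦ x⁻¹ * y) x

/-- The points are linked by propositional equations and the values are read in the model space,
since tangent spaces at provably equal points need not be syntactically the same type. -/
theorem mfderiv_leftMul_leftMul (a b c x y : G) (hy : b * x = y) (hc : a * b = c)
    (v : TangentSpace (𝓡 n) x) :
    (mfderiv (𝓡 n) (𝓡 n) (fun z : G ↦ a * z) y
      (mfderiv (𝓡 n) (𝓡 n) (fun z : G ↦ b * z) x v : EuclideanSpace ℝ (Fin n)) :
        EuclideanSpace ℝ (Fin n)) =
      mfderiv (𝓡 n) (𝓡 n) (fun z : G ↦ c * z) x v := by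
  subst hc
  have h : (fun z : G ↦ a * b * z) = (fun z ↦ a * z) ∘ fun z ↦ b * z := by
    ext z; simp [mul_assoc]
  rw [h]
  exact (mfderiv_comp_apply_of_eq x (mdifferentiableAt_leftMul a y)
    (mdifferentiableAt_leftMul b x) hy v).symm

theorem mfderiv_rightMul_rightMul (a b c x y : G) (hy : x * b = y) (hc : b * a = c)
    (v : TangentSpace (𝓡 n) x) :
    (mfderiv (𝓡 n) (𝓡 n) (fun z : G ↦ z * a) y
      (mfderiv (𝓡 n) (𝓡 n) (fun z : G ↦ z * b) x v : EuclideanSpace ℝ (Fin n)) :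
        EuclideanSpace ℝ (Fin n)) =
      mfderiv (𝓡 n) (𝓡 n) (fun z : G ↦ z * c) x v := by
  subst hc
  have h : (fun z : G ↦ z * (b * a)) = (fun z ↦ z * a) ∘ fun z ↦ z * b := by
    ext z; simp [mul_assoc]
  rw [h]
  exact (mfderiv_comp_apply_of_eq x (mdifferentiableAt_rightMul a y)
    (mdifferentiableAt_rightMul b x) hy v).symm

theorem mfderiv_leftMul_rightMul (a b x y z : G) (hy : x * b = y) (hz : a * x = z)
    (v : TangentSpace (𝓡 n) x) :
    (mfderiv (𝓡 n) (𝓡 n) (fun z : G ↦ a * z) y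
      (mfderiv (𝓡 n) (𝓡 n) (fun z : G ↦ z * b) x v : EuclideanSpace ℝ (Fin n)) :
        EuclideanSpace ℝ (Fin n)) =
      mfderiv (𝓡 n) (𝓡 n) (fun z : G ↦ z * b) z
        (mfderiv (𝓡 n) (𝓡 n) (fun z : G ↦ a * z) x v : EuclideanSpace ℝ (Fin n)) := by
  have h : (fun z : G ↦ a * z) ∘ (fun z ↦ z * b) = (fun z ↦ z * b) ∘ fun z ↦ a * z := by
    ext z; simp [mul_assoc]
  have h₁ := mfderiv_comp_apply_of_eq x (mdifferentiableAt_leftMul a y)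
    (mdifferentiableAt_rightMul b x) hy v
  have h₂ := mfderiv_comp_apply_of_eq x (mdifferentiableAt_rightMul b z)
    (mdifferentiableAt_leftMul a x) hz v
  rw [h] at h₁
  exact h₁.symm.trans h₂

theorem mfderiv_one_mul (x : G) (v : TangentSpace (𝓡 n) x) :
    (mfderiv (𝓡 n) (𝓡 n) (fun z : G ↦ 1 * z) x v : EuclideanSpace ℝ (Fin n)) = v := by
  have h : (fun z : G ↦ 1 * z) = id := by ext z; simp
  rw [h, mfderiv_id]
  rfl

theorem mfderiv_mul_one (x : G) (v : TangentSpace (𝓡 n) x) :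
    (mfderiv (𝓡 n) (𝓡 n) (fun z : G ↦ z * 1) x v : EuclideanSpace ℝ (Fin n)) = v := by
  have h : (fun z : G ↦ z * 1) = id := by ext z; simp
  rw [h, mfderiv_id]
  rfl

@[simp]
theorem leftTriv_leftFrame (x : G) (v : EuclideanSpace ℝ (Fin n)) :
    leftTriv x (leftFrame x v) = v :=
  (mfderiv_leftMul_leftMul x⁻¹ x 1 1 x (mul_one x) (inv_mul_cancel x) v).trans
    (mfderiv_one_mul 1 v)

@[simp]
theorem leftFrame_leftTriv (x : G) (v : TangentSpace (𝓡 n) x) :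
    leftFrame x (leftTriv x v) = v :=
  (mfderiv_leftMul_leftMul x x⁻¹ 1 x 1 (inv_mul_cancel x) (mul_inv_cancel x) v).trans
    (mfderiv_one_mul x v)

theorem leftFrame_mul (a x : G) (v : EuclideanSpace ℝ (Fin n)) :
    mfderiv (𝓡 n) (𝓡 n) (fun y : G ↦ a * y) x (leftFrame x v) = leftFrame (a * x) v :=
  mfderiv_leftMul_leftMul a x (a * x) 1 x (mul_one x) rfl v

@[simp]
theorem leftTriv_mfderiv_leftMul (a x : G) (v : TangentSpace (𝓡 n) x) :
    leftTriv (a * x) (mfderiv (𝓡 n) (𝓡 n) (fun y : G ↦ a * y) x v) = leftTriv x v := by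
  conv_lhs => rw [← leftFrame_leftTriv x v]
  rw [leftFrame_mul, leftTriv_leftFrame]

theorem rightFrame_mul (a x : G) (v : EuclideanSpace ℝ (Fin n)) :
    mfderiv (𝓡 n) (𝓡 n) (fun y : G ↦ y * a) x (rightFrame x v) = rightFrame (x * a) v :=
  mfderiv_rightMul_rightMul a x (x * a) 1 x (one_mul x) rfl v

@[simp]
theorem leftFrame_one (v : EuclideanSpace ℝ (Fin n)) : leftFrame (1 : G) v = v :=
  mfderiv_one_mul 1 v

@[simp]
theorem rightFrame_one (v : EuclideanSpace ℝ (Fin n)) : rightFrame (1 : G) v = v :=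
  mfderiv_mul_one 1 v

@[simp]
theorem leftTriv_one (v : TangentSpace (𝓡 n) (1 : G)) : leftTriv (1 : G) v = v :=
  (congrArg (leftTriv (1 : G)) (leftFrame_one (G := G) v)).symm.trans (leftTriv_leftFrame (1 : G) v)

/-- The adjoint action of `x⁻¹` on the Lie algebra, where `x` acts on the right. -/
def coAd (x : G) : EuclideanSpace ℝ (Fin n) →L[ℝ] EuclideanSpace ℝ (Fin n) :=
  leftTriv x ∘L rightFrame x

/-- Left and right translations commute, so the base point `x` drops out and only the adjoint action
of `a` remains. -/
theorem leftTriv_mfderiv_rightMul (a x : G) (v : TangentSpace (𝓡 n) x) :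
    leftTriv (x * a) (mfderiv (𝓡 n) (𝓡 n) (fun y : G ↦ y * a) x v) = coAd a (leftTriv x v) := by
  have h := mfderiv_leftMul_rightMul x a 1 a x (one_mul a) (mul_one x) (leftTriv x v)
  have h' : (mfderiv (𝓡 n) (𝓡 n) (fun y : G ↦ y * a) x v) =
      mfderiv (𝓡 n) (𝓡 n) (fun y : G ↦ x * y) a (rightFrame a (leftTriv x v)) := by
    conv_lhs => rw [← leftFrame_leftTriv x v]
    exact h.symm
  rw [h', leftTriv_mfderiv_leftMul]
  rfl

@[simp]
theorem coAd_one (v : EuclideanSpace ℝ (Fin n)) : coAd (1 : G) v = v :=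
  (congrArg (leftTriv (1 : G)) (rightFrame_one (G := G) v)).trans (leftTriv_one (G := G) v)

theorem coAd_mul (x a : G) (v : EuclideanSpace ℝ (Fin n)) :
    coAd (x * a) v = coAd a (coAd x v) := by
  have h := leftTriv_mfderiv_rightMul a x (rightFrame x v)
  rw [rightFrame_mul] at h
  exact h

@[simp]
theorem coAd_inv_coAd (x : G) (v : EuclideanSpace ℝ (Fin n)) : coAd x⁻¹ (coAd x v) = v := by
  rw [← coAd_mul, mul_inv_cancel, coAd_one]

@[simp]
theorem coAd_coAd_inv (x : G) (v : EuclideanSpace ℝ (Fin n)) : coAd x (coAd x⁻¹ v) = v := by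
  rw [← coAd_mul, inv_mul_cancel, coAd_one]

/-! ### Smoothness of invariant fields and of left coordinates -/

/-- The field is the tangent map of multiplication applied to the vector `(0, v)` at `(x, 1)`, which
depends smoothly on `x`. -/
theorem contMDiff_leftFrame (v : EuclideanSpace ℝ (Fin n)) :
    ContMDiff (𝓡 n) (𝓡 n).tangent ∞
      (fun x : G ↦ (⟨x, leftFrame x v⟩ : TangentBundle (𝓡 n) G)) := by
  have h₁ : ContMDiff (𝓡 n) ((𝓡 n).prod (𝓡 n)).tangent ∞ (fun x : G ↦
      (equivTangentBundleProd (𝓡 n) G (𝓡 n) G).symm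
        (TotalSpace.mk' (EuclideanSpace ℝ (Fin n)) x 0,
          TotalSpace.mk' (EuclideanSpace ℝ (Fin n)) 1 v)) :=
    contMDiff_equivTangentBundleProd_symm.comp
      ((contMDiff_zeroSection ℝ _).prodMk contMDiff_const)
  have h₂ := ((contMDiff_mul (𝓡 n) ∞ (G := G)).contMDiff_tangentMap
    (m := ∞) (by simp)).comp h₁
  refine h₂.congr fun x ↦ ?_
  refine TotalSpace.ext (mul_one x).symm (heq_of_eq ?_)
  have h := mfderiv_prod_eq_add_apply (I := 𝓡 n) (I' := 𝓡 n) (I'' := 𝓡 n)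
    (f := fun p : G × G ↦ p.1 * p.2) (p := (x, 1)) (v := (0, v))
    ((contMDiff_mul (𝓡 n) ∞).mdifferentiableAt (by simp))
  refine Eq.trans ?_ h.symm
  refine Eq.trans (zero_add _).symm (congrArg (· + _) ?_)
  exact (map_zero _).symm

theorem contMDiff_rightFrame (v : EuclideanSpace ℝ (Fin n)) :
    ContMDiff (𝓡 n) (𝓡 n).tangent ∞
      (fun x : G ↦ (⟨x, rightFrame x v⟩ : TangentBundle (𝓡 n) G)) := by
  have h₁ : ContMDiff (𝓡 n) ((𝓡 n).prod (𝓡 n)).tangent ∞ (fun x : G ↦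
      (equivTangentBundleProd (𝓡 n) G (𝓡 n) G).symm
        (TotalSpace.mk' (EuclideanSpace ℝ (Fin n)) 1 v,
          TotalSpace.mk' (EuclideanSpace ℝ (Fin n)) x 0)) :=
    contMDiff_equivTangentBundleProd_symm.comp
      (contMDiff_const.prodMk (contMDiff_zeroSection ℝ _))
  have h₂ := ((contMDiff_mul (𝓡 n) ∞ (G := G)).contMDiff_tangentMap
    (m := ∞) (by simp)).comp h₁
  refine h₂.congr fun x ↦ ?_
  refine TotalSpace.ext (one_mul x).symm (heq_of_eq ?_)
  have h := mfderiv_prod_eq_add_apply (I := 𝓡 n) (I' := 𝓡 n) (I'' := 𝓡 n)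
    (f := fun p : G × G ↦ p.1 * p.2) (p := (1, x)) (v := (v, 0))
    ((contMDiff_mul (𝓡 n) ∞).mdifferentiableAt (by simp))
  refine Eq.trans ?_ h.symm
  refine Eq.trans (add_zero _).symm (congrArg (_ + ·) ?_)
  exact (map_zero _).symm

open ContinuousLinearMap in
theorem contMDiffAt_clm_of_apply {M F : Type*} [TopologicalSpace M]
    [ChartedSpace (EuclideanSpace ℝ (Fin n)) M] [NormedAddCommGroup F] [NormedSpace ℝ F]
    {f : M → EuclideanSpace ℝ (Fin n) →L[ℝ] F} {x₀ : M}
    (h : ∀ v, ContMDiffAt (𝓡 n) 𝓘(ℝ, F) ∞ (fun x ↦ f x v) x₀) :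
    ContMDiffAt (𝓡 n) 𝓘(ℝ, EuclideanSpace ℝ (Fin n) →L[ℝ] F) ∞ f x₀ := by
  let b := EuclideanSpace.basisFun (Fin n) ℝ
  have hf : f = fun x ↦ ∑ i, smulRightL ℝ (EuclideanSpace ℝ (Fin n)) F
      (EuclideanSpace.proj i) (f x (b i)) := by
    ext x v
    conv_lhs => rw [← b.sum_repr v]
    simp [b]
  rw [hf]
  exact contMDiffAt_finsetSum fun i _ ↦
    (ContinuousLinearMap.contMDiff _).contMDiffAt.comp x₀ (h (b i))

/-- A section of a bundle of linear maps out of the tangent bundle is smooth as soon as its values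
on left-invariant fields are smooth. -/
theorem contMDiffAt_hom_of_leftFrame {F : Type*} [NormedAddCommGroup F] [NormedSpace ℝ F]
    {V : G → Type*} [TopologicalSpace (TotalSpace F V)] [∀ x, AddCommGroup (V x)]
    [∀ x, Module ℝ (V x)] [∀ x, TopologicalSpace (V x)] [∀ x, IsTopologicalAddGroup (V x)]
    [∀ x, ContinuousSMul ℝ (V x)] [FiberBundle F V] [VectorBundle ℝ F V]
    {σ : ∀ x : G, TangentSpace (𝓡 n) x →L[ℝ] V x} {x₀ : G}
    (h : ∀ v, ContMDiffAt (𝓡 n) ((𝓡 n).prod 𝓘(ℝ, F)) ∞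
      (fun x ↦ TotalSpace.mk' F x (σ x (leftFrame x v))) x₀) :
    ContMDiffAt (𝓡 n) ((𝓡 n).prod 𝓘(ℝ, EuclideanSpace ℝ (Fin n) →L[ℝ] F)) ∞
      (fun x ↦ TotalSpace.mk' (EuclideanSpace ℝ (Fin n) →L[ℝ] F)
        (E := fun x ↦ TangentSpace (𝓡 n) x →L[ℝ] V x) x (σ x)) x₀ := by
  rw [contMDiffAt_hom_bundle]
  refine ⟨contMDiffAt_id, ?_⟩
  let e₁ := trivializationAt (EuclideanSpace ℝ (Fin n)) (TangentSpace (𝓡 n) : G → Type _) x₀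
  let e₂ := trivializationAt F V x₀
  -- In the local trivializations the section reads `B x ∘ (A x)⁻¹`. Both factors are smooth, since
  -- inversion of operators is smooth at an invertible one.
  let A (x : G) : EuclideanSpace ℝ (Fin n) →L[ℝ] EuclideanSpace ℝ (Fin n) :=
    e₁.continuousLinearMapAt ℝ x ∘L leftFrame x
  let B (x : G) : EuclideanSpace ℝ (Fin n) →L[ℝ] F :=
    e₂.continuousLinearMapAt ℝ x ∘L σ x ∘L leftFrame x
  have mem₁ : ∀ᶠ x in 𝓝 x₀, x ∈ e₁.baseSet :=
    e₁.open_baseSet.mem_nhds (FiberBundle.mem_baseSet_trivializationAt _ _ x₀)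
  have mem₂ : ∀ᶠ x in 𝓝 x₀, x ∈ e₂.baseSet :=
    e₂.open_baseSet.mem_nhds (FiberBundle.mem_baseSet_trivializationAt _ _ x₀)
  have hA : ContMDiffAt (𝓡 n) 𝓘(ℝ, EuclideanSpace ℝ (Fin n) →L[ℝ] EuclideanSpace ℝ (Fin n)) ∞
      A x₀ := by
    refine contMDiffAt_clm_of_apply fun v ↦ ?_
    have := ((contMDiffAt_totalSpace (IB := 𝓡 n)).1 ((contMDiff_leftFrame (G := G) v).contMDiffAt (x := x₀))).2
    refine this.congr_of_eventuallyEq ?_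
    filter_upwards [mem₁] with x hx
    simp only [A, ContinuousLinearMap.comp_apply]
    exact congrFun (e₁.coe_linearMapAt_of_mem (R := ℝ) hx) _
  have hB : ContMDiffAt (𝓡 n) 𝓘(ℝ, EuclideanSpace ℝ (Fin n) →L[ℝ] F) ∞ B x₀ := by
    refine contMDiffAt_clm_of_apply fun v ↦ ?_
    have := ((contMDiffAt_totalSpace (IB := 𝓡 n)).1 (h v)).2
    refine this.congr_of_eventuallyEq ?_
    filter_upwards [mem₂] with x hx
    simp only [B, ContinuousLinearMap.comp_apply]
    exact congrFun (e₂.coe_linearMapAt_of_mem (R := ℝ) hx) _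
  let Φ (x : G) : EuclideanSpace ℝ (Fin n) ≃L[ℝ] TangentSpace (𝓡 n) x :=
    ContinuousLinearEquiv.equivOfInverse (leftFrame x) (leftTriv x)
      (leftTriv_leftFrame x) (leftFrame_leftTriv x)
  have hAeq (x : G) (hx : x ∈ e₁.baseSet) :
      A x = ((Φ x).trans (e₁.continuousLinearEquivAt ℝ x hx) :
        EuclideanSpace ℝ (Fin n) →L[ℝ] EuclideanSpace ℝ (Fin n)) := by
    ext v : 1
    simp only [A, ContinuousLinearMap.comp_apply]
    exact congrFun (e₁.coe_linearMapAt_of_mem (R := ℝ) hx) _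
  have hinv : ContMDiffAt (𝓡 n) 𝓘(ℝ, EuclideanSpace ℝ (Fin n) →L[ℝ] EuclideanSpace ℝ (Fin n)) ∞
      (fun x ↦ (A x).inverse) x₀ := by
    have h₀ := hAeq x₀ mem₁.self_of_nhds
    have : ContDiffAt ℝ ∞ ContinuousLinearMap.inverse (A x₀) := h₀ ▸ contDiffAt_map_inverse _
    exact this.contMDiffAt.comp x₀ hA
  refine (hB.clm_comp hinv).congr_of_eventuallyEq ?_
  filter_upwards [mem₁, mem₂] with x hx₁ hx₂
  rw [hAeq x hx₁, ContinuousLinearMap.inverse_equiv,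
    ContinuousLinearMap.inCoordinates_eq hx₁ hx₂]
  ext v : 1
  simp only [B, ContinuousLinearMap.comp_apply]
  refine Eq.trans ?_ (congrFun (e₂.coe_linearMapAt_of_mem (R := ℝ) hx₂) _).symm
  change _ = (e₂ ⟨x, σ x (leftFrame x (leftTriv x ((e₁.continuousLinearEquivAt ℝ x hx₁).symm v)))⟩).2
  rw [leftFrame_leftTriv]
  rfl

/-- The coordinates of a vector field in the left trivialization. -/
def leftCoord (X : ∀ x : G, TangentSpace (𝓡 n) x) (x : G) : EuclideanSpace ℝ (Fin n) :=
  leftTriv x (X x)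

@[simp]
theorem leftFrame_leftCoord (X : ∀ x : G, TangentSpace (𝓡 n) x) (x : G) :
    leftFrame x (leftCoord X x) = X x :=
  leftFrame_leftTriv x _

theorem contMDiff_leftTriv :
    ContMDiff (𝓡 n) ((𝓡 n).prod 𝓘(ℝ, EuclideanSpace ℝ (Fin n) →L[ℝ] EuclideanSpace ℝ (Fin n))) ∞
      (fun x : G ↦ TotalSpace.mk' (EuclideanSpace ℝ (Fin n) →L[ℝ] EuclideanSpace ℝ (Fin n))
        (E := fun x : G ↦ TangentSpace (𝓡 n) x →L[ℝ]
          Bundle.Trivial G (EuclideanSpace ℝ (Fin n)) x) x (leftTriv x)) := by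
  intro x₀
  refine contMDiffAt_hom_of_leftFrame (V := Bundle.Trivial G (EuclideanSpace ℝ (Fin n)))
    (σ := fun x ↦ leftTriv x) fun v ↦ ?_
  rw [contMDiffAt_section]
  refine contMDiffAt_const (c := v) |>.congr_of_eventuallyEq (Filter.Eventually.of_forall fun x ↦ ?_)
  exact leftTriv_leftFrame x v

theorem SmoothFieldAt.leftCoord {X : ∀ x : G, TangentSpace (𝓡 n) x} {x : G}
    (hX : SmoothFieldAt X x) :
    ContMDiffAt (𝓡 n) 𝓘(ℝ, EuclideanSpace ℝ (Fin n)) ∞ (leftCoord X) x := by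
  have := ContMDiffAt.clm_bundle_apply (F₁ := EuclideanSpace ℝ (Fin n))
    (F₂ := EuclideanSpace ℝ (Fin n)) (E₁ := fun x : G ↦ TangentSpace (𝓡 n) x)
    (E₂ := Bundle.Trivial G (EuclideanSpace ℝ (Fin n))) (b := id) (v := X)
    (ϕ := fun x ↦ leftTriv x) (contMDiff_leftTriv.contMDiffAt (x := x)) hX
  exact ((contMDiffAt_totalSpace (IB := 𝓡 n)).1 this).2

theorem mdifferentiableAt_leftCoord {X : ∀ x : G, TangentSpace (𝓡 n) x} {x : G}
    (hX : MDifferentiableAt (𝓡 n) (𝓡 n).tangent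
      (fun y ↦ (⟨y, X y⟩ : TangentBundle (𝓡 n) G)) x) :
    MDifferentiableAt (𝓡 n) 𝓘(ℝ, EuclideanSpace ℝ (Fin n)) (leftCoord X) x := by
  have := MDifferentiableAt.clm_bundle_apply (F₁ := EuclideanSpace ℝ (Fin n))
    (F₂ := EuclideanSpace ℝ (Fin n)) (E₁ := fun x : G ↦ TangentSpace (𝓡 n) x)
    (E₂ := Bundle.Trivial G (EuclideanSpace ℝ (Fin n))) (b := id) (v := X)
    (ϕ := fun x ↦ leftTriv x) ((contMDiff_leftTriv.contMDiffAt (x := x)).mdifferentiableAt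
      (by simp)) hX
  exact ((mdifferentiableAt_totalSpace (IB := 𝓡 n) _).1 this).2

theorem leftFrame_eq_sum (x : G) (v : EuclideanSpace ℝ (Fin n)) :
    leftFrame x v = ∑ i, v i • leftFrame x (EuclideanSpace.basisFun (Fin n) ℝ i) := by
  conv_lhs => rw [← (EuclideanSpace.basisFun (Fin n) ℝ).sum_repr v]
  simp only [map_sum, map_smul]
  rfl

theorem contMDiffAt_leftFrame {k : WithTop ℕ∞} (hk : k ≤ ∞) {ξ : G → EuclideanSpace ℝ (Fin n)} {x : G}
    (hξ : ContMDiffAt (𝓡 n) 𝓘(ℝ, EuclideanSpace ℝ (Fin n)) k ξ x) :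
    ContMDiffAt (𝓡 n) (𝓡 n).tangent k
      (fun y ↦ (⟨y, leftFrame y (ξ y)⟩ : TangentBundle (𝓡 n) G)) x := by
  simp_rw [leftFrame_eq_sum _ (ξ _)]
  refine ContMDiffAt.sum_section fun i _ ↦ ContMDiffAt.smul_section ?_
    (((contMDiff_leftFrame _).of_le hk).contMDiffAt)
  exact (EuclideanSpace.proj (𝕜 := ℝ) i).contMDiff.contMDiffAt.comp x hξ

theorem SmoothFieldAt.mdifferentiableAt {X : ∀ x : G, TangentSpace (𝓡 n) x} {x : G}
    (hX : SmoothFieldAt X x) : MDifferentiableAt (𝓡 n) (𝓡 n).tangent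
      (fun y ↦ (⟨y, X y⟩ : TangentBundle (𝓡 n) G)) x :=
  ContMDiffAt.mdifferentiableAt hX (by simp)

theorem smoothFieldAt_leftFrame (v : EuclideanSpace ℝ (Fin n)) (x : G) :
    SmoothFieldAt (fun y : G ↦ leftFrame y v) x :=
  (contMDiff_leftFrame v).contMDiffAt

theorem smoothFieldAt_rightFrame (v : EuclideanSpace ℝ (Fin n)) (x : G) :
    SmoothFieldAt (fun y : G ↦ rightFrame y v) x :=
  (contMDiff_rightFrame v).contMDiffAt

@[simp]
theorem leftCoord_leftFrame (ξ : G → EuclideanSpace ℝ (Fin n)) :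
    leftCoord (fun y : G ↦ leftFrame y (ξ y)) = ξ :=
  funext fun y ↦ leftTriv_leftFrame y _

/-! ### The flat connection and brackets in left coordinates -/

variable (n G) in
/-- The flat connection for which left-invariant vector fields are parallel. -/
def flatConnection : Connection n G where
  toFun Y x := leftFrame x ∘L mvfderiv (𝓡 n) (leftCoord Y) x
  isCovariantDerivativeOnUniv :=
    { add := by
        intro Y Y' x hY hY' _
        have : leftCoord (Y + Y') = leftCoord Y + leftCoord Y' := by
          ext1 y
          exact map_add (leftTriv y) _ _
        rw [this, mvfderiv_add (mdifferentiableAt_leftCoord hY) (mdifferentiableAt_leftCoord hY'),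
          ContinuousLinearMap.comp_add]
      leibniz := by
        intro Y f x hY hf _
        have : leftCoord (f • Y) = f • leftCoord Y := by
          ext1 y
          exact map_smul (leftTriv y) _ _
        rw [this, mvfderiv_smul hf (mdifferentiableAt_leftCoord hY)]
        ext v : 1
        simp }

theorem flatConnection_apply (Y : ∀ x : G, TangentSpace (𝓡 n) x) (x : G)
    (v : TangentSpace (𝓡 n) x) :
    flatConnection n G Y x v = leftFrame x (mvfderiv (𝓡 n) (leftCoord Y) x v) :=
  rfl

variable (G) in
/-- The Lie bracket of the Lie algebra of `G`, on the model space. -/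
def lieBr (v w : EuclideanSpace ℝ (Fin n)) : EuclideanSpace ℝ (Fin n) :=
  Bracket.bracket (L := GroupLieAlgebra (𝓡 n) G) (M := GroupLieAlgebra (𝓡 n) G) v w

theorem lieBr_add (u v w : EuclideanSpace ℝ (Fin n)) :
    lieBr G u (v + w) = lieBr G u v + lieBr G u w :=
  lie_add (L := GroupLieAlgebra (𝓡 n) G) (M := GroupLieAlgebra (𝓡 n) G) u v w

theorem add_lieBr (u v w : EuclideanSpace ℝ (Fin n)) :
    lieBr G (u + v) w = lieBr G u w + lieBr G v w :=
  add_lie (L := GroupLieAlgebra (𝓡 n) G) (M := GroupLieAlgebra (𝓡 n) G) u v w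

theorem lieBr_smul (c : ℝ) (v w : EuclideanSpace ℝ (Fin n)) :
    lieBr G v (c • w) = c • lieBr G v w :=
  lie_smul (L := GroupLieAlgebra (𝓡 n) G) (M := GroupLieAlgebra (𝓡 n) G) c v w

theorem smul_lieBr (c : ℝ) (v w : EuclideanSpace ℝ (Fin n)) :
    lieBr G (c • v) w = c • lieBr G v w :=
  smul_lie (L := GroupLieAlgebra (𝓡 n) G) (M := GroupLieAlgebra (𝓡 n) G) c v w

theorem lieBr_skew (v w : EuclideanSpace ℝ (Fin n)) : -lieBr G w v = lieBr G v w :=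
  lie_skew (L := GroupLieAlgebra (𝓡 n) G) v w

theorem lieBr_jacobi (u v w : EuclideanSpace ℝ (Fin n)) :
    lieBr G u (lieBr G v w) = lieBr G (lieBr G u v) w + lieBr G v (lieBr G u w) :=
  leibniz_lie (L₁ := GroupLieAlgebra (𝓡 n) G) (L₂ := GroupLieAlgebra (𝓡 n) G) (M := GroupLieAlgebra (𝓡 n) G) u v w

theorem mlieBracket_leftFrame (v w : EuclideanSpace ℝ (Fin n)) (x : G) :
    mlieBracket (𝓡 n) (fun y : G ↦ leftFrame y v) (fun y : G ↦ leftFrame y w) x =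
      leftFrame x (lieBr G v w) :=
  (congrFun (mulInvariantVector_mlieBracket (I := 𝓡 n) (G := G) v w) x).symm

theorem mvfderiv_leftCoord_leftFrame (v : EuclideanSpace ℝ (Fin n)) (x : G) :
    mvfderiv (𝓡 n) (leftCoord (fun y : G ↦ leftFrame y v)) x = 0 := by
  rw [leftCoord_leftFrame (fun _ : G ↦ v)]
  exact mvfderiv_const _

theorem flatConnection_leftFrame (v : EuclideanSpace ℝ (Fin n)) (x : G) :
    flatConnection n G (fun y : G ↦ leftFrame y v) x = 0 := by
  ext u : 1
  rw [flatConnection_apply, mvfderiv_leftCoord_leftFrame]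
  exact map_zero _

/-- Torsion is tensorial, so it can be computed on left-invariant extensions. These are parallel,
and only the bracket term survives. -/
theorem torsion_flatConnection (x : G) (u v : TangentSpace (𝓡 n) x) :
    (flatConnection n G).torsion x u v = -leftFrame x (lieBr G (leftTriv x u) (leftTriv x v)) := by
  have h := (flatConnection n G).torsion_apply
    (smoothFieldAt_leftFrame (leftTriv x u) x).mdifferentiableAt
    (smoothFieldAt_leftFrame (leftTriv x v) x).mdifferentiableAt
  rw [flatConnection_leftFrame, flatConnection_leftFrame, mlieBracket_leftFrame] at h
  simpa using h

/-- The bracket of two vector fields in the left trivialization. -/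
theorem leftTriv_mlieBracket {X Y : ∀ x : G, TangentSpace (𝓡 n) x} {x : G}
    (hX : MDifferentiableAt (𝓡 n) (𝓡 n).tangent
      (fun y ↦ (⟨y, X y⟩ : TangentBundle (𝓡 n) G)) x)
    (hY : MDifferentiableAt (𝓡 n) (𝓡 n).tangent
      (fun y ↦ (⟨y, Y y⟩ : TangentBundle (𝓡 n) G)) x) :
    leftTriv x (mlieBracket (𝓡 n) X Y x) =
      mvfderiv (𝓡 n) (leftCoord Y) x (X x) - mvfderiv (𝓡 n) (leftCoord X) x (Y x) +
        lieBr G (leftCoord X x) (leftCoord Y x) := by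
  -- The torsion of the flat connection is computed twice: as a tensor, and as `∇_X Y - ∇_Y X - [X,
  -- Y]`.
  have h := (flatConnection n G).torsion_apply hX hY
  rw [torsion_flatConnection] at h
  have h' := congrArg (leftTriv x) h
  rw [map_sub, map_sub, map_neg, flatConnection_apply, flatConnection_apply, leftTriv_leftFrame,
    leftTriv_leftFrame, leftTriv_leftFrame] at h'
  rw [leftCoord, leftCoord, eq_comm, ← sub_eq_zero]
  rw [← sub_eq_zero] at h'
  rw [← neg_eq_zero, ← h']
  abel

/-! ### Brackets as commutators of derivations -/

theorem contMDiffAt_mvfderiv_apply {k : WithTop ℕ∞} {F : Type*} [NormedAddCommGroup F]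
    [NormedSpace ℝ F] {f : G → F} {X : ∀ x : G, TangentSpace (𝓡 n) x} {x : G}
    (hf : ContMDiffAt (𝓡 n) 𝓘(ℝ, F) (k + 1) f x)
    (hX : ContMDiffAt (𝓡 n) (𝓡 n).tangent k
      (fun y ↦ (⟨y, X y⟩ : TangentBundle (𝓡 n) G)) x) :
    ContMDiffAt (𝓡 n) 𝓘(ℝ, F) k (fun y ↦ mvfderiv (𝓡 n) f y (X y)) x := by
  have := ContMDiffAt.clm_apply_of_inCoordinates (b₁ := id) (b₂ := f)
    (ϕ := fun y ↦ mfderiv (𝓡 n) 𝓘(ℝ, F) f y) (v := X) (m₀ := x)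
    (hf.mfderiv_const (m := k) le_rfl) hX (hf.of_le le_self_add)
  have := ((contMDiffAt_totalSpace (IB := 𝓘(ℝ, F))).1 this).2
  exact (by simpa using this : ContMDiffAt (𝓡 n) 𝓘(ℝ, F) k
    (fun y ↦ (mfderiv (𝓡 n) 𝓘(ℝ, F) f y (X y) : F)) x)

theorem mvfderiv_clm_comp {M F F' : Type*} [TopologicalSpace M]
    [ChartedSpace (EuclideanSpace ℝ (Fin n)) M] [NormedAddCommGroup F] [NormedSpace ℝ F]
    [NormedAddCommGroup F'] [NormedSpace ℝ F'] (L : F →L[ℝ] F') {f : M → F} {x : M}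
    (hf : MDifferentiableAt (𝓡 n) 𝓘(ℝ, F) f x) (v : TangentSpace (𝓡 n) x) :
    mvfderiv (𝓡 n) (fun y ↦ L (f y)) x v = L (mvfderiv (𝓡 n) f x v) := by
  have h : mfderiv (𝓡 n) 𝓘(ℝ, F') (L ∘ f) x v = L (mfderiv (𝓡 n) 𝓘(ℝ, F) f x v) := by
    rw [mfderiv_comp_apply x L.mdifferentiableAt hf, ContinuousLinearMap.mfderiv_eq]
    rfl
  exact h

theorem SmoothFieldAt.mlieBracket {M : Type*} [TopologicalSpace M]
    [ChartedSpace (EuclideanSpace ℝ (Fin n)) M] [IsManifold (𝓡 n) ∞ M]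
    {X Y : ∀ x : M, TangentSpace (𝓡 n) x} {x : M} (hX : SmoothFieldAt X x)
    (hY : SmoothFieldAt Y x) : SmoothFieldAt (mlieBracket (𝓡 n) X Y) x := by
  have : IsManifold (𝓡 n) (minSmoothness ℝ 2) M := by
    rw [minSmoothness_of_isRCLikeNormedField]; infer_instance
  have : IsManifold (𝓡 n) (((⊤ : ℕ∞) : WithTop ℕ∞) + 1) M := by simpa
  exact ContMDiffAt.mlieBracket_vectorField (n := ⊤) (m := ⊤) hX hY (by simp)

/-- Expand the Jacobi identity for `X`, `Y`, `f • Z` by the product rule and subtract `f` times the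
one for `X`, `Y`, `Z`. The mixed terms cancel and the claim is left as the coefficient of `Z`, which
is nonzero at `x`. -/
theorem mvfderiv_mlieBracket_real {f : G → ℝ} {X Y : ∀ x : G, TangentSpace (𝓡 n) x} {x : G}
    (hf : ContMDiffAt (𝓡 n) 𝓘(ℝ) ∞ f x) (hX : SmoothFieldAt X x) (hY : SmoothFieldAt Y x) :
    mvfderiv (𝓡 n) f x (mlieBracket (𝓡 n) X Y x) =
      mvfderiv (𝓡 n) (fun y ↦ mvfderiv (𝓡 n) f y (Y y)) x (X x) -
        mvfderiv (𝓡 n) (fun y ↦ mvfderiv (𝓡 n) f y (X y)) x (Y x) := by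
  -- A nonvanishing `Z` exists only in positive dimension.
  rcases Nat.eq_zero_or_pos n with rfl | hn
  · have h0 : mlieBracket (𝓡 0) X Y x = 0 := Subsingleton.elim (α := EuclideanSpace ℝ (Fin 0)) _ _
    have h1 : X x = 0 := Subsingleton.elim (α := EuclideanSpace ℝ (Fin 0)) _ _
    have h2 : Y x = 0 := Subsingleton.elim (α := EuclideanSpace ℝ (Fin 0)) _ _
    simp [h0, h1, h2]
  let z : EuclideanSpace ℝ (Fin n) := EuclideanSpace.single ⟨0, hn⟩ 1
  have hz : z ≠ 0 := by simp [z]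
  let Z : ∀ x : G, TangentSpace (𝓡 n) x := fun y ↦ leftFrame y z
  have hZ (y : G) : SmoothFieldAt Z y := smoothFieldAt_leftFrame z y
  have hfev : ∀ᶠ y in 𝓝 x, MDifferentiableAt (𝓡 n) 𝓘(ℝ) f y :=
    ((contMDiffAt_iff_contMDiffAt_nhds (by simp)).1 (hf.of_le (m := 1) (by simp))).mono fun y hy ↦
      hy.mdifferentiableAt (by simp)
  have hfx : MDifferentiableAt (𝓡 n) 𝓘(ℝ) f x := hf.mdifferentiableAt (by simp)
  have key {X Y : ∀ x : G, TangentSpace (𝓡 n) x} (hX : SmoothFieldAt X x)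
      (hY : SmoothFieldAt Y x) :
      mlieBracket (𝓡 n) X (mlieBracket (𝓡 n) Y (f • Z)) x =
        mvfderiv (𝓡 n) (fun y ↦ mvfderiv (𝓡 n) f y (Y y)) x (X x) • Z x +
          mvfderiv (𝓡 n) f x (Y x) • mlieBracket (𝓡 n) X Z x +
          (mvfderiv (𝓡 n) f x (X x) • mlieBracket (𝓡 n) Y Z x +
          f x • mlieBracket (𝓡 n) X (mlieBracket (𝓡 n) Y Z) x) := by
    have hg : ContMDiffAt (𝓡 n) 𝓘(ℝ) ∞ (fun y ↦ mvfderiv (𝓡 n) f y (Y y)) x :=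
      contMDiffAt_mvfderiv_apply (k := ∞) (by simpa using hf) hY
    have h : mlieBracket (𝓡 n) Y (f • Z) =ᶠ[𝓝 x]
        (fun y ↦ mvfderiv (𝓡 n) f y (Y y)) • Z + f • mlieBracket (𝓡 n) Y Z := by
      filter_upwards [hfev] with y hy
      exact mlieBracket_smul_right hy (hZ y).mdifferentiableAt
    rw [(Filter.EventuallyEq.refl _ X).mlieBracket_vectorField_eq h, mlieBracket_add_right,
      mlieBracket_smul_right (hg.mdifferentiableAt (by simp)) (hZ x).mdifferentiableAt,
      mlieBracket_smul_right hfx (hY.mlieBracket (hZ x)).mdifferentiableAt]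
    · exact (hg.mdifferentiableAt (by simp)).smul_section (hZ x).mdifferentiableAt
    · exact hfx.smul_section (hY.mlieBracket (hZ x)).mdifferentiableAt
  have hle : minSmoothness ℝ 2 ≤ (∞ : WithTop ℕ∞) := by
    rw [minSmoothness_of_isRCLikeNormedField]; exact ENat.LEInfty.out
  have hfZ : SmoothFieldAt (f • Z) x := ContMDiffAt.smul_section hf (hZ x)
  have J₁ := leibniz_identity_mlieBracket_apply (ContMDiffAt.of_le hX hle)
    (ContMDiffAt.of_le hY hle) (ContMDiffAt.of_le hfZ hle)
  have J₂ := leibniz_identity_mlieBracket_apply (ContMDiffAt.of_le hX hle)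
    (ContMDiffAt.of_le hY hle) (ContMDiffAt.of_le (hZ x) hle)
  rw [key hX hY, key hY hX, mlieBracket_smul_right hfx (hZ x).mdifferentiableAt, J₂] at J₁
  have hZx : Z x ≠ 0 := fun h ↦ hz (by
    have := congrArg (leftTriv x) h
    rwa [leftTriv_leftFrame, map_zero] at this)
  have h3 : (mvfderiv (𝓡 n) f x (mlieBracket (𝓡 n) X Y x) -
      (mvfderiv (𝓡 n) (fun y ↦ mvfderiv (𝓡 n) f y (Y y)) x (X x) -
        mvfderiv (𝓡 n) (fun y ↦ mvfderiv (𝓡 n) f y (X y)) x (Y x))) • Z x = 0 := by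
    rw [← sub_eq_zero] at J₁
    rw [← neg_eq_zero, ← J₁]
    module
  exact sub_eq_zero.1 ((smul_eq_zero.1 h3).resolve_right hZx)

/-- The Lie bracket of vector fields is the commutator of derivations. -/
theorem mvfderiv_mlieBracket {f : G → EuclideanSpace ℝ (Fin n)}
    {X Y : ∀ x : G, TangentSpace (𝓡 n) x} {x : G}
    (hf : ContMDiffAt (𝓡 n) 𝓘(ℝ, EuclideanSpace ℝ (Fin n)) ∞ f x) (hX : SmoothFieldAt X x)
    (hY : SmoothFieldAt Y x) :
    mvfderiv (𝓡 n) f x (mlieBracket (𝓡 n) X Y x) =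
      mvfderiv (𝓡 n) (fun y ↦ mvfderiv (𝓡 n) f y (Y y)) x (X x) -
        mvfderiv (𝓡 n) (fun y ↦ mvfderiv (𝓡 n) f y (X y)) x (Y x) := by
  have hfev : ∀ᶠ y in 𝓝 x, MDifferentiableAt (𝓡 n) 𝓘(ℝ, EuclideanSpace ℝ (Fin n)) f y :=
    ((contMDiffAt_iff_contMDiffAt_nhds (by simp)).1 (hf.of_le (m := 1) (by simp))).mono fun y hy ↦
      hy.mdifferentiableAt (by simp)
  have hg {Y : ∀ x : G, TangentSpace (𝓡 n) x} (hY : SmoothFieldAt Y x) :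
      MDifferentiableAt (𝓡 n) 𝓘(ℝ, EuclideanSpace ℝ (Fin n))
        (fun y ↦ mvfderiv (𝓡 n) f y (Y y)) x :=
    (contMDiffAt_mvfderiv_apply (k := ∞) (by simpa using hf) hY).mdifferentiableAt (by simp)
  ext i
  let L : EuclideanSpace ℝ (Fin n) →L[ℝ] ℝ := EuclideanSpace.proj i
  have key {X Y : ∀ x : G, TangentSpace (𝓡 n) x} (hY : SmoothFieldAt Y x) :
      mvfderiv (𝓡 n) (fun y ↦ mvfderiv (𝓡 n) (fun z ↦ L (f z)) y (Y y)) x (X x) =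
        L (mvfderiv (𝓡 n) (fun y ↦ mvfderiv (𝓡 n) f y (Y y)) x (X x)) := by
    rw [← mvfderiv_clm_comp L (hg hY)]
    have : (fun y ↦ mvfderiv (𝓡 n) (fun z ↦ L (f z)) y (Y y)) =ᶠ[𝓝 x]
        fun y ↦ L (mvfderiv (𝓡 n) f y (Y y)) := by
      filter_upwards [hfev] with y hy using mvfderiv_clm_comp L hy _
    rw [mvfderiv, mvfderiv, this.mfderiv_eq]
    rfl
  have h := mvfderiv_mlieBracket_real (f := fun y ↦ L (f y))
    (L.contMDiff.contMDiffAt.comp x hf) hX hY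
  rw [key hX, key hY, mvfderiv_clm_comp L hfev.self_of_nhds] at h
  exact h

theorem mvfderiv_congr {M F : Type*} [TopologicalSpace M]
    [ChartedSpace (EuclideanSpace ℝ (Fin n)) M] [NormedAddCommGroup F] [NormedSpace ℝ F]
    {f g : M → F} {x : M} (h : f =ᶠ[𝓝 x] g) : mvfderiv (𝓡 n) f x = mvfderiv (𝓡 n) g x := by
  have : mfderiv (𝓡 n) 𝓘(ℝ, F) f x = mfderiv (𝓡 n) 𝓘(ℝ, F) g x := h.mfderiv_eq
  rw [mvfderiv, mvfderiv, this]
  rfl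

/-! ### Mixed partials and the differential of the adjoint action -/

section MixedPartials

variable {M F : Type*} [TopologicalSpace M] [ChartedSpace (EuclideanSpace ℝ (Fin n)) M]
  [IsManifold (𝓡 n) ∞ M] [NormedAddCommGroup F] [NormedSpace ℝ F]

theorem mvfderiv_eq_fderiv_comp_extChartAt {x₀ : M} {f : M → F} {g : EuclideanSpace ℝ (Fin n) → F}
    {L : EuclideanSpace ℝ (Fin n) →L[ℝ] F} (hg : HasFDerivAt g L (extChartAt (𝓡 n) x₀ x₀))
    (h : f =ᶠ[𝓝 x₀] fun x ↦ g (extChartAt (𝓡 n) x₀ x)) (v : TangentSpace (𝓡 n) x₀) :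
    mvfderiv (𝓡 n) f x₀ v = L (mvfderiv (𝓡 n) (extChartAt (𝓡 n) x₀) x₀ v) := by
  have hχ : MDifferentiableAt (𝓡 n) 𝓘(ℝ, EuclideanSpace ℝ (Fin n)) (extChartAt (𝓡 n) x₀) x₀ :=
    (contMDiffAt_extChartAt (n := ∞)).mdifferentiableAt (by simp)
  have h₁ := (hg.hasMFDerivAt.comp x₀ hχ.hasMFDerivAt).mfderiv
  have h₂ : mfderiv (𝓡 n) 𝓘(ℝ, F) f x₀ =
      mfderiv (𝓡 n) 𝓘(ℝ, F) (g ∘ extChartAt (𝓡 n) x₀) x₀ := h.mfderiv_eq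
  rw [mvfderiv, h₂, h₁]
  rfl

/-- Mixed partial derivatives along the two factors of a product commute. -/
theorem mvfderiv_mvfderiv_comm {H : M → M → F} {x₀ : M}
    (hH : ContMDiffAt ((𝓡 n).prod (𝓡 n)) 𝓘(ℝ, F) ∞ (Function.uncurry H) (x₀, x₀))
    (u v : TangentSpace (𝓡 n) x₀) :
    mvfderiv (𝓡 n) (fun y ↦ mvfderiv (𝓡 n) (fun z ↦ H z y) x₀ v) x₀ u =
      mvfderiv (𝓡 n) (fun z ↦ mvfderiv (𝓡 n) (fun y ↦ H z y) x₀ u) x₀ v := by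
  let E := EuclideanSpace ℝ (Fin n)
  let χ := extChartAt (𝓡 n) x₀
  let p₀ := χ x₀
  let D : TangentSpace (𝓡 n) x₀ →L[ℝ] E := mvfderiv (𝓡 n) χ x₀
  -- In the chart both iterated derivatives are values of the second derivative of `Φ` at `(p₀, p₀)`
  -- on `(0, D u)` and `(D v, 0)`, in the two orders.
  let Φ : E × E → F := fun r ↦ H (χ.symm r.1) (χ.symm r.2)
  have hsymm : ContMDiffAt 𝓘(ℝ, E) (𝓡 n) ∞ χ.symm p₀ := by
    have := contMDiffWithinAt_extChartAt_symm_range (I := 𝓡 n) (n := ∞) x₀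
      (mem_extChartAt_target x₀)
    rwa [ModelWithCorners.range_eq_univ, contMDiffWithinAt_univ] at this
  have hχx : χ.symm p₀ = x₀ := extChartAt_to_inv x₀
  have hΦ : ContDiffAt ℝ ∞ Φ (p₀, p₀) := by
    rw [← contMDiffAt_iff_contDiffAt]
    have h₁ : ContMDiffAt 𝓘(ℝ, E × E) (𝓡 n) ∞ (fun r : E × E ↦ χ.symm r.1) (p₀, p₀) :=
      ContMDiffAt.comp (p₀, p₀) (f := fun r : E × E ↦ r.1) hsymm contDiff_fst.contMDiff.contMDiffAt
    have h₂ : ContMDiffAt 𝓘(ℝ, E × E) (𝓡 n) ∞ (fun r : E × E ↦ χ.symm r.2) (p₀, p₀) :=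
      ContMDiffAt.comp (p₀, p₀) (f := fun r : E × E ↦ r.2) hsymm contDiff_snd.contMDiff.contMDiffAt
    refine ContMDiffAt.comp (p₀, p₀) (g := Function.uncurry H)
      (f := fun r : E × E ↦ (χ.symm r.1, χ.symm r.2)) ?_ (h₁.prodMk h₂)
    simpa only [hχx] using hH
  have hev : ∀ᶠ r in 𝓝 (p₀, p₀), DifferentiableAt ℝ Φ r :=
    ((hΦ.of_le (m := 1) (by simp)).eventually (by simp)).mono fun r hr ↦
      hr.differentiableAt (by simp)
  have hd : HasFDerivAt (fderiv ℝ Φ) (fderiv ℝ (fderiv ℝ Φ) (p₀, p₀)) (p₀, p₀) :=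
    ((hΦ.fderiv_right (m := ∞) (by simp)).differentiableAt (by simp)).hasFDerivAt
  have hχc : ContinuousAt χ x₀ := continuousAt_extChartAt x₀
  have hinv : ∀ᶠ x in 𝓝 x₀, χ.symm (χ x) = x := by
    filter_upwards [extChartAt_source_mem_nhds (I := 𝓡 n) x₀] with x hx using χ.left_inv hx
  have h₁ : (fun y ↦ mvfderiv (𝓡 n) (fun z ↦ H z y) x₀ v) =ᶠ[𝓝 x₀]
      fun y ↦ fderiv ℝ Φ (p₀, χ y) (D v, 0) := by
    have hc : Filter.Tendsto (fun y ↦ (p₀, χ y)) (𝓝 x₀) (𝓝 (p₀, p₀)) :=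
      tendsto_const_nhds.prodMk_nhds hχc
    filter_upwards [hinv, hc.eventually hev] with y hy hdiff
    have := hdiff.hasFDerivAt.comp (f := fun p ↦ (p, χ y)) p₀ ((hasFDerivAt_id p₀).prodMk (hasFDerivAt_const (χ y) p₀))
    refine (mvfderiv_eq_fderiv_comp_extChartAt this ?_ v).trans rfl
    filter_upwards [hinv] with z hz
    exact congrArg₂ H hz.symm hy.symm
  have h₂ : (fun z ↦ mvfderiv (𝓡 n) (fun y ↦ H z y) x₀ u) =ᶠ[𝓝 x₀]
      fun z ↦ fderiv ℝ Φ (χ z, p₀) (0, D u) := by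
    have hc : Filter.Tendsto (fun y ↦ (χ y, p₀)) (𝓝 x₀) (𝓝 (p₀, p₀)) :=
      hχc.prodMk_nhds tendsto_const_nhds
    filter_upwards [hinv, hc.eventually hev] with y hy hdiff
    have := hdiff.hasFDerivAt.comp (f := fun p ↦ (χ y, p)) p₀ ((hasFDerivAt_const (χ y) p₀).prodMk (hasFDerivAt_id p₀))
    refine (mvfderiv_eq_fderiv_comp_extChartAt this ?_ u).trans rfl
    filter_upwards [hinv] with z hz
    exact congrArg₂ H hy.symm hz.symm
  have e₁ : mvfderiv (𝓡 n) (fun y ↦ mvfderiv (𝓡 n) (fun z ↦ H z y) x₀ v) x₀ u =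
      fderiv ℝ (fderiv ℝ Φ) (p₀, p₀) (0, D u) (D v, 0) := by
    have := (hd.comp (f := fun p ↦ (p₀, p)) p₀ ((hasFDerivAt_const p₀ p₀).prodMk (hasFDerivAt_id p₀))).clm_apply
      (hasFDerivAt_const ((D v, 0) : E × E) p₀)
    refine (mvfderiv_eq_fderiv_comp_extChartAt this h₁ u).trans ?_
    simp [D, χ]
  have e₂ : mvfderiv (𝓡 n) (fun z ↦ mvfderiv (𝓡 n) (fun y ↦ H z y) x₀ u) x₀ v =
      fderiv ℝ (fderiv ℝ Φ) (p₀, p₀) (D v, 0) (0, D u) := by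
    have := (hd.comp (f := fun p ↦ (p, p₀)) p₀ ((hasFDerivAt_id p₀).prodMk (hasFDerivAt_const p₀ p₀))).clm_apply
      (hasFDerivAt_const ((0, D u) : E × E) p₀)
    refine (mvfderiv_eq_fderiv_comp_extChartAt this h₂ v).trans ?_
    simp [D, χ]
  rw [e₁, e₂]
  exact (hΦ.isSymmSndFDerivAt (by
    rw [minSmoothness_of_isRCLikeNormedField]; exact ENat.LEInfty.out)).eq _ _

end MixedPartials

/-- Left and right multiplications commute. Tested on a chart `f`, the two iterated derivatives at
`1` are the mixed partials of `(z, y) ↦ f (z * y)`; the differential of a chart is injective, so the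
bracket itself vanishes. -/
theorem mlieBracket_leftFrame_rightFrame_one (u v : EuclideanSpace ℝ (Fin n)) :
    mlieBracket (𝓡 n) (fun y : G ↦ leftFrame y u) (fun y : G ↦ rightFrame y v) 1 = 0 := by
  let f : G → EuclideanSpace ℝ (Fin n) := extChartAt (𝓡 n) (1 : G)
  have hf : ContMDiffAt (𝓡 n) 𝓘(ℝ, EuclideanSpace ℝ (Fin n)) ∞ f 1 := contMDiffAt_extChartAt
  have hfev : ∀ᶠ y in 𝓝 1, MDifferentiableAt (𝓡 n) 𝓘(ℝ, EuclideanSpace ℝ (Fin n)) f y :=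
    ((contMDiffAt_iff_contMDiffAt_nhds (by simp)).1 (hf.of_le (m := 1) (by simp))).mono
      fun y hy ↦ hy.mdifferentiableAt (by simp)
  have h := mvfderiv_mlieBracket hf (smoothFieldAt_leftFrame u 1) (smoothFieldAt_rightFrame v 1)
  have h₁ : (fun y : G ↦ mvfderiv (𝓡 n) f y (rightFrame y v)) =ᶠ[𝓝 1]
      fun y ↦ mvfderiv (𝓡 n) (fun z ↦ f (z * y)) 1 v := by
    filter_upwards [hfev] with y hy
    exact (mfderiv_comp_apply_of_eq (I := 𝓡 n) (I' := 𝓡 n) (g := f) (f := fun z ↦ z * y) (x := 1) hy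
      (mdifferentiableAt_rightMul y 1) (one_mul y) v).symm
  have h₂ : (fun y : G ↦ mvfderiv (𝓡 n) f y (leftFrame y u)) =ᶠ[𝓝 1]
      fun z ↦ mvfderiv (𝓡 n) (fun y ↦ f (z * y)) 1 u := by
    filter_upwards [hfev] with y hy
    exact (mfderiv_comp_apply_of_eq (I := 𝓡 n) (I' := 𝓡 n) (g := f) (f := fun z ↦ y * z) (x := 1) hy
      (mdifferentiableAt_leftMul y 1) (mul_one y) u).symm
  have hH : ContMDiffAt ((𝓡 n).prod (𝓡 n)) 𝓘(ℝ, EuclideanSpace ℝ (Fin n)) ∞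
      (Function.uncurry fun z y : G ↦ f (z * y)) (1, 1) := by
    refine ContMDiffAt.comp (g := f) (f := fun p : G × G ↦ p.1 * p.2) (1, 1) ?_
      (contMDiff_mul (𝓡 n) ∞).contMDiffAt
    simpa using hf
  have h₃ : mvfderiv (𝓡 n) f 1 (mlieBracket (𝓡 n) (fun y : G ↦ leftFrame y u)
      (fun y : G ↦ rightFrame y v) 1) = 0 := by
    rw [h, sub_eq_zero]
    have e₁ := mvfderiv_mvfderiv_comm hH u v
    rw [mvfderiv_congr h₁, mvfderiv_congr h₂, leftFrame_one, rightFrame_one]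
    exact e₁
  obtain ⟨e, he⟩ := isInvertible_mfderiv_extChartAt (I := 𝓡 n) (mem_extChartAt_source (1 : G))
  refine e.injective ?_
  rw [map_zero]
  refine Eq.trans ?_ h₃
  exact congrArg (fun L : _ →L[ℝ] _ ↦ L _) he

theorem contMDiff_coAd (v : EuclideanSpace ℝ (Fin n)) :
    ContMDiff (𝓡 n) 𝓘(ℝ, EuclideanSpace ℝ (Fin n)) ∞ (fun x : G ↦ coAd x v) :=
  fun x ↦ (smoothFieldAt_rightFrame v x).leftCoord

/-- The derivative of the adjoint representation is the Lie bracket. -/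
theorem mvfderiv_coAd (u v : EuclideanSpace ℝ (Fin n)) :
    mvfderiv (𝓡 n) (fun x : G ↦ coAd x v) 1 u = -lieBr G u v := by
  -- `coAd x v` is the left coordinate of the right-invariant field of `v`. Its bracket with a
  -- left-invariant field is zero at `1`, so the coordinate formula for brackets yields the
  -- derivative.
  have h := leftTriv_mlieBracket (smoothFieldAt_leftFrame u (1 : G)).mdifferentiableAt
    (smoothFieldAt_rightFrame v (1 : G)).mdifferentiableAt
  rw [mlieBracket_leftFrame_rightFrame_one, map_zero, mvfderiv_leftCoord_leftFrame,
    leftCoord_leftFrame (fun _ : G ↦ u), leftFrame_one] at h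
  have h' : leftCoord (fun y : G ↦ rightFrame y v) = fun x : G ↦ coAd x v := rfl
  rw [h'] at h
  have h₁ : coAd (1 : G) v = v := coAd_one v
  simp only [h₁] at h
  rw [eq_neg_iff_add_eq_zero, h]
  exact congrArg (· + lieBr G u v) (sub_zero _).symm

theorem mdifferentiableAt_bilinear {M F₁ F₂ F₃ : Type*} [TopologicalSpace M]
    [ChartedSpace (EuclideanSpace ℝ (Fin n)) M] [NormedAddCommGroup F₁] [NormedSpace ℝ F₁]
    [NormedAddCommGroup F₂] [NormedSpace ℝ F₂] [NormedAddCommGroup F₃] [NormedSpace ℝ F₃]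
    (B : F₁ →L[ℝ] F₂ →L[ℝ] F₃) {f : M → F₁} {g : M → F₂} {x : M}
    (hf : MDifferentiableAt (𝓡 n) 𝓘(ℝ, F₁) f x) (hg : MDifferentiableAt (𝓡 n) 𝓘(ℝ, F₂) g x) :
    MDifferentiableAt (𝓡 n) 𝓘(ℝ, F₃) (fun y ↦ B (f y) (g y)) x :=
  ((B.isBoundedBilinearMap.hasFDerivAt (f x, g x)).differentiableAt.mdifferentiableAt).comp x
    (hf.prodMk_space hg)

theorem mvfderiv_bilinear {M F₁ F₂ F₃ : Type*} [TopologicalSpace M]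
    [ChartedSpace (EuclideanSpace ℝ (Fin n)) M] [NormedAddCommGroup F₁] [NormedSpace ℝ F₁]
    [NormedAddCommGroup F₂] [NormedSpace ℝ F₂] [NormedAddCommGroup F₃] [NormedSpace ℝ F₃]
    (B : F₁ →L[ℝ] F₂ →L[ℝ] F₃) {f : M → F₁} {g : M → F₂} {x : M}
    (hf : MDifferentiableAt (𝓡 n) 𝓘(ℝ, F₁) f x) (hg : MDifferentiableAt (𝓡 n) 𝓘(ℝ, F₂) g x)
    (v : TangentSpace (𝓡 n) x) :
    mvfderiv (𝓡 n) (fun y ↦ B (f y) (g y)) x v =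
      B (f x) (mvfderiv (𝓡 n) g x v) + B (mvfderiv (𝓡 n) f x v) (g x) := by
  have hp : HasMFDerivAt (𝓡 n) 𝓘(ℝ, F₁ × F₂) (fun y ↦ (f y, g y)) x
      ((mfderiv (𝓡 n) 𝓘(ℝ, F₁) f x).prod (mfderiv (𝓡 n) 𝓘(ℝ, F₂) g x)) :=
    ⟨hf.hasMFDerivAt.1.prodMk hg.hasMFDerivAt.1, hf.hasMFDerivAt.2.prodMk hg.hasMFDerivAt.2⟩
  have h := (HasMFDerivAt.comp (g := fun p : F₁ × F₂ ↦ B p.1 p.2) (f := fun y ↦ (f y, g y)) x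
    (B.isBoundedBilinearMap.hasFDerivAt (f x, g x)).hasMFDerivAt hp).mfderiv
  have h' : mvfderiv (𝓡 n) (fun y ↦ B (f y) (g y)) x v =
      mfderiv (𝓡 n) 𝓘(ℝ, F₃) ((fun p : F₁ × F₂ ↦ B p.1 p.2) ∘ fun y ↦ (f y, g y)) x v := rfl
  rw [h', h]
  rfl

variable (G) in
/-- The Lie bracket of the Lie algebra of `G` as a continuous bilinear map. -/
def lieBrL : EuclideanSpace ℝ (Fin n) →L[ℝ] EuclideanSpace ℝ (Fin n) →L[ℝ]
    EuclideanSpace ℝ (Fin n) :=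
  (LinearMap.mk₂ ℝ (lieBr G) add_lieBr smul_lieBr lieBr_add lieBr_smul).toContinuousBilinearMap

@[simp]
theorem lieBrL_apply (u v : EuclideanSpace ℝ (Fin n)) : lieBrL G u v = lieBr G u v := rfl

/-! ### Bi-invariant metrics -/

section Metric

/-- The metric of `g` on the Lie algebra. -/
def metricOne (g : Metric n G) :
    EuclideanSpace ℝ (Fin n) →L[ℝ] EuclideanSpace ℝ (Fin n) →L[ℝ] ℝ :=
  g.inner 1

theorem IsBiinvariant.inner_eq {g : Metric n G} (hg : IsBiinvariant g) (x : G)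
    (u v : TangentSpace (𝓡 n) x) :
    g.inner x u v = metricOne g (leftTriv x u) (leftTriv x v) := by
  have h := hg.1 x 1 (leftTriv x u) (leftTriv x v)
  have hx (w : TangentSpace (𝓡 n) x) :
      mfderiv (𝓡 n) (𝓡 n) (fun y ↦ x * y) 1 (leftTriv x w) = w := leftFrame_leftTriv x w
  rw [hx, hx] at h
  refine Eq.trans ?_ h
  rw [mul_one]

theorem IsBiinvariant.inner_rightFrame {g : Metric n G} (hg : IsBiinvariant g) (x : G)
    (u v : EuclideanSpace ℝ (Fin n)) :
    g.inner x (rightFrame x u) (rightFrame x v) = metricOne g u v := by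
  have h := hg.2 x 1 u v
  refine Eq.trans ?_ h
  rw [one_mul]
  rfl

theorem IsBiinvariant.metricOne_coAd {g : Metric n G} (hg : IsBiinvariant g) (x : G)
    (u v : EuclideanSpace ℝ (Fin n)) :
    metricOne g (coAd x u) (coAd x v) = metricOne g u v := by
  rw [← hg.inner_rightFrame x u v, hg.inner_eq]
  rfl

/-- Differentiate the invariance of `B` at the identity in the direction `u`. -/
theorem lieBr_skew_of_coAd {B : EuclideanSpace ℝ (Fin n) →L[ℝ] EuclideanSpace ℝ (Fin n) →L[ℝ] ℝ}
    (hB : ∀ (x : G) u v, B (coAd x u) (coAd x v) = B u v) (u v w : EuclideanSpace ℝ (Fin n)) :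
    B (lieBr G u v) w = -B v (lieBr G u w) := by
  have hd (v : EuclideanSpace ℝ (Fin n)) :
      MDifferentiableAt (𝓡 n) 𝓘(ℝ, EuclideanSpace ℝ (Fin n)) (fun x : G ↦ coAd x v) 1 :=
    (contMDiff_coAd v).contMDiffAt.mdifferentiableAt (by simp)
  have h := mvfderiv_bilinear B (hd v) (hd w) u
  simp only [hB] at h
  rw [mvfderiv_const, mvfderiv_coAd, mvfderiv_coAd, coAd_one, coAd_one] at h
  have h' : (0 : ℝ) = B v (-lieBr G u w) + B (-lieBr G u v) w := h
  simp only [map_neg, neg_apply] at h'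
  linarith

/-- The left-invariant field of bilinear forms with prescribed value on the Lie algebra. -/
def leftBilin (B : EuclideanSpace ℝ (Fin n) →L[ℝ] EuclideanSpace ℝ (Fin n) →L[ℝ] ℝ) (x : G) :
    TangentSpace (𝓡 n) x →L[ℝ] TangentSpace (𝓡 n) x →L[ℝ] ℝ :=
  ContinuousLinearMap.precomp ℝ (leftTriv x) ∘L B ∘L leftTriv x

/-- The left-invariant metric with prescribed value on the Lie algebra. -/
def leftMetric (B : EuclideanSpace ℝ (Fin n) →L[ℝ] EuclideanSpace ℝ (Fin n) →L[ℝ] ℝ)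
    (hsymm : ∀ u v, B u v = B v u) (hpos : ∀ v, v ≠ 0 → 0 < B v v) : Metric n G where
  inner x := leftBilin B x
  symm x u v := hsymm _ _
  pos x v hv := hpos (leftTriv x v) fun h ↦ hv (by rw [← leftFrame_leftTriv x v, h, map_zero])
  isVonNBounded x := by
    -- On the compact unit sphere `B v v` has a positive minimum, so by homogeneity its unit ball is
    -- bounded. An empty sphere means dimension zero.
    have hS : Bornology.IsVonNBounded ℝ {v : EuclideanSpace ℝ (Fin n) | B v v < 1} := by
      rw [NormedSpace.isVonNBounded_iff]
      rcases (Metric.sphere (0 : EuclideanSpace ℝ (Fin n)) 1).eq_empty_or_nonempty with h0 | hne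
      · have : Subsingleton (EuclideanSpace ℝ (Fin n)) := by
          rw [← not_nontrivial_iff_subsingleton]
          intro _
          obtain ⟨v, hv⟩ := NormedSpace.sphere_nonempty
            (E := EuclideanSpace ℝ (Fin n)) (x := 0) (r := 1) |>.2 zero_le_one
          exact h0.le hv
        exact Set.subsingleton_of_subsingleton.finite.isBounded
      · have hc : Continuous fun v : EuclideanSpace ℝ (Fin n) ↦ B v v := by fun_prop
        obtain ⟨w, hw, hmin⟩ := (isCompact_sphere (0 : EuclideanSpace ℝ (Fin n)) 1).exists_isMinOn
          hne hc.continuousOn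
        have hw0 : w ≠ 0 := by
          rintro rfl
          simp at hw
        have hpw := hpos w hw0
        refine (Metric.isBounded_closedBall (x := (0 : EuclideanSpace ℝ (Fin n)))
          (r := Real.sqrt (1 / B w w))).subset fun v hv ↦ ?_
        rw [mem_closedBall_zero_iff]
        refine Real.le_sqrt_of_sq_le ?_
        rcases eq_or_ne v 0 with rfl | hv0
        · simpa using hpw.le
        have hn : 0 < ‖v‖ := norm_pos_iff.2 hv0
        have hmem : ‖v‖⁻¹ • v ∈ Metric.sphere (0 : EuclideanSpace ℝ (Fin n)) 1 := by
          simp [norm_smul, hn.ne']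
        have h1 : B w w ≤ B (‖v‖⁻¹ • v) (‖v‖⁻¹ • v) := hmin hmem
        have hv1 : B v v < 1 := hv
        simp only [map_smul, smul_apply, smul_eq_mul] at h1
        rw [le_div_iff₀ hpw]
        have h2 : ‖v‖ ^ 2 * B w w ≤ ‖v‖ ^ 2 * (‖v‖⁻¹ * (‖v‖⁻¹ * B v v)) := by gcongr
        have h3 : ‖v‖ ^ 2 * (‖v‖⁻¹ * (‖v‖⁻¹ * B v v)) = B v v := by field_simp
        linarith
    have hsub : {v : TangentSpace (𝓡 n) x | leftBilin B x v v < 1} ⊆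
        leftFrame x '' {v : EuclideanSpace ℝ (Fin n) | B v v < 1} :=
      fun v hv ↦ ⟨leftTriv x v, hv, leftFrame_leftTriv x v⟩
    exact (hS.image (leftFrame x)).subset hsub
  contMDiff x := by
    refine contMDiffAt_hom_of_leftFrame (F := EuclideanSpace ℝ (Fin n) →L[ℝ] ℝ)
      (V := fun x : G ↦ TangentSpace (𝓡 n) x →L[ℝ] Bundle.Trivial G ℝ x)
      (σ := fun x ↦ leftBilin B x) fun u ↦ ?_
    refine contMDiffAt_hom_of_leftFrame (F := ℝ)
      (V := fun x : G ↦ Bundle.Trivial G ℝ x)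
      (σ := fun x ↦ leftBilin B x (leftFrame x u)) fun v ↦ ?_
    rw [contMDiffAt_section]
    refine contMDiffAt_const (c := B u v) |>.congr_of_eventuallyEq
      (Filter.Eventually.of_forall fun x ↦ ?_)
    exact congrArg₂ (fun u v ↦ B u v) (leftTriv_leftFrame x u) (leftTriv_leftFrame x v)

theorem isBiinvariant_leftMetric
    {B : EuclideanSpace ℝ (Fin n) →L[ℝ] EuclideanSpace ℝ (Fin n) →L[ℝ] ℝ}
    (hsymm : ∀ u v, B u v = B v u) (hpos : ∀ v, v ≠ 0 → 0 < B v v)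
    (hB : ∀ (x : G) u v, B (coAd x u) (coAd x v) = B u v) :
    IsBiinvariant (leftMetric (G := G) B hsymm hpos) := by
  refine ⟨fun a x v w ↦ ?_, fun a x v w ↦ ?_⟩
  · change B (leftTriv (a * x) _) (leftTriv (a * x) _) = B (leftTriv x v) (leftTriv x w)
    rw [leftTriv_mfderiv_leftMul, leftTriv_mfderiv_leftMul]
  · change B (leftTriv (x * a) _) (leftTriv (x * a) _) = B (leftTriv x v) (leftTriv x w)
    rw [leftTriv_mfderiv_rightMul, leftTriv_mfderiv_rightMul, hB]

theorem leftMetric_inner_one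
    {B : EuclideanSpace ℝ (Fin n) →L[ℝ] EuclideanSpace ℝ (Fin n) →L[ℝ] ℝ}
    (hsymm : ∀ u v, B u v = B v u) (hpos : ∀ v, v ≠ 0 → 0 < B v v)
    (u v : EuclideanSpace ℝ (Fin n)) :
    (leftMetric (G := G) B hsymm hpos).inner 1 u v = B u v :=
  congrArg₂ (fun u v ↦ B u v) (leftTriv_one (G := G) u) (leftTriv_one (G := G) v)

end Metric

/-! ### Left-invariant complex structures -/

/-- The left-invariant complex structure defined by an integrable complex structure on the Lie
algebra. -/
def leftComplex (J : EuclideanSpace ℝ (Fin n) →L[ℝ] EuclideanSpace ℝ (Fin n))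
    (hJ : ∀ v, J (J v) = -v)
    (hN : ∀ u v, lieBr G (J u) (J v) - J (lieBr G (J u) v) - J (lieBr G u (J v)) - lieBr G u v = 0) :
    ComplexStructure n G where
  J x := leftFrame x ∘L J ∘L leftTriv x
  contMDiff_J x := by
    refine contMDiffAt_hom_of_leftFrame (F := EuclideanSpace ℝ (Fin n))
      (V := fun x : G ↦ TangentSpace (𝓡 n) x)
      (σ := fun x ↦ leftFrame x ∘L J ∘L leftTriv x) fun u ↦ ?_
    refine (contMDiff_leftFrame (J u)).contMDiffAt.congr_of_eventuallyEq
      (Filter.Eventually.of_forall fun x ↦ ?_)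
    change TotalSpace.mk' _ x (leftFrame x (J (leftTriv x (leftFrame x u)))) = _
    rw [leftTriv_leftFrame]
  J_J x v := by
    change leftFrame x (J (leftTriv x (leftFrame x (J (leftTriv x v))))) = -v
    rw [leftTriv_leftFrame, hJ, map_neg, leftFrame_leftTriv]
  nijenhuis_eq_zero x X Y hX hY := by
    have hJX {X : ∀ x : G, TangentSpace (𝓡 n) x} (hX : SmoothFieldAt X x) :
        SmoothFieldAt (fun y ↦ (leftFrame y ∘L J ∘L leftTriv y) (X y)) x :=
      contMDiffAt_leftFrame le_rfl (J.contMDiff.contMDiffAt.comp x hX.leftCoord)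
    have hcJ (X : ∀ x : G, TangentSpace (𝓡 n) x) :
        leftCoord (fun y ↦ (leftFrame y ∘L J ∘L leftTriv y) (X y)) = fun y ↦ J (leftCoord X y) :=
      leftCoord_leftFrame (fun y ↦ J (leftCoord X y))
    have hdJ {X : ∀ x : G, TangentSpace (𝓡 n) x} (hX : SmoothFieldAt X x)
        (v : TangentSpace (𝓡 n) x) :
        mvfderiv (𝓡 n) (leftCoord (fun y ↦ (leftFrame y ∘L J ∘L leftTriv y) (X y))) x v =
          J (mvfderiv (𝓡 n) (leftCoord X) x v) := by
      rw [hcJ, mvfderiv_clm_comp J (mdifferentiableAt_leftCoord hX.mdifferentiableAt)]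
    have hbr {X Y : ∀ x : G, TangentSpace (𝓡 n) x} (hX : SmoothFieldAt X x)
        (hY : SmoothFieldAt Y x) :=
      leftTriv_mlieBracket hX.mdifferentiableAt hY.mdifferentiableAt
    -- `J` is constant in left coordinates, hence commutes with differentiation. The derivative
    -- terms cancel by `J² = -1`, leaving the algebraic Nijenhuis tensor `hN`.
    have key : leftTriv x
        (mlieBracket (𝓡 n) (fun y ↦ (leftFrame y ∘L J ∘L leftTriv y) (X y))
          (fun y ↦ (leftFrame y ∘L J ∘L leftTriv y) (Y y)) x
        - leftFrame x (J (leftTriv x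
          (mlieBracket (𝓡 n) (fun y ↦ (leftFrame y ∘L J ∘L leftTriv y) (X y)) Y x)))
        - leftFrame x (J (leftTriv x
          (mlieBracket (𝓡 n) X (fun y ↦ (leftFrame y ∘L J ∘L leftTriv y) (Y y)) x)))
        - mlieBracket (𝓡 n) X Y x) = 0 := by
      rw [map_sub, map_sub, map_sub, leftTriv_leftFrame, leftTriv_leftFrame,
        hbr (hJX hX) (hJX hY), hbr (hJX hX) hY, hbr hX (hJX hY), hbr hX hY,
        hdJ hX, hdJ hX, hdJ hY, hdJ hY, hcJ, hcJ]
      simp only [map_add, map_sub, hJ]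
      refine Eq.trans ?_ (hN (leftCoord X x) (leftCoord Y x))
      abel
    have := congrArg (leftFrame x) key
    rw [leftFrame_leftTriv, map_zero] at this
    exact this

theorem isLeftInvariant_leftComplex
    {J : EuclideanSpace ℝ (Fin n) →L[ℝ] EuclideanSpace ℝ (Fin n)} (hJ : ∀ v, J (J v) = -v)
    (hN : ∀ u v, lieBr G (J u) (J v) - J (lieBr G (J u) v) - J (lieBr G u (J v)) - lieBr G u v = 0) :
    IsLeftInvariant (leftComplex (G := G) J hJ hN) := fun a x v ↦ by
  change leftFrame (a * x) (J (leftTriv (a * x) _)) = mfderiv (𝓡 n) (𝓡 n) (fun y ↦ a * y) x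
    (leftFrame x (J (leftTriv x v)))
  rw [leftTriv_mfderiv_leftMul, leftFrame_mul]

theorem leftComplex_J_one
    {J : EuclideanSpace ℝ (Fin n) →L[ℝ] EuclideanSpace ℝ (Fin n)} (hJ : ∀ v, J (J v) = -v)
    (hN : ∀ u v, lieBr G (J u) (J v) - J (lieBr G (J u) v) - J (lieBr G u (J v)) - lieBr G u v = 0)
    (v : EuclideanSpace ℝ (Fin n)) : (leftComplex (G := G) J hJ hN).J 1 v = J v :=
  (leftFrame_one (G := G) _).trans (congrArg J (leftTriv_one (G := G) v))

/-- The action of a complex structure on the Lie algebra. -/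
def complexOne (C : ComplexStructure n G) :
    EuclideanSpace ℝ (Fin n) →L[ℝ] EuclideanSpace ℝ (Fin n) :=
  C.J 1

theorem complexOne_complexOne (C : ComplexStructure n G) (v : EuclideanSpace ℝ (Fin n)) :
    complexOne C (complexOne C v) = -v :=
  C.J_J 1 v

theorem IsLeftInvariant.J_leftFrame {C : ComplexStructure n G} (hC : IsLeftInvariant C) (x : G)
    (v : EuclideanSpace ℝ (Fin n)) : C.J x (leftFrame x v) = leftFrame x (complexOne C v) := by
  have h := hC x 1 v
  refine Eq.trans ?_ h
  rw [mul_one]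
  rfl

theorem IsLeftInvariant.leftTriv_J {C : ComplexStructure n G} (hC : IsLeftInvariant C) (x : G)
    (v : TangentSpace (𝓡 n) x) : leftTriv x (C.J x v) = complexOne C (leftTriv x v) := by
  conv_lhs => rw [← leftFrame_leftTriv x v]
  rw [hC.J_leftFrame, leftTriv_leftFrame]

theorem isHermitian_leftComplex
    {J : EuclideanSpace ℝ (Fin n) →L[ℝ] EuclideanSpace ℝ (Fin n)} (hJ : ∀ v, J (J v) = -v)
    (hN : ∀ u v, lieBr G (J u) (J v) - J (lieBr G (J u) v) - J (lieBr G u (J v)) - lieBr G u v = 0)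
    {g : Metric n G} (hg : IsBiinvariant g)
    (h : ∀ u v, metricOne g (J u) (J v) = metricOne g u v) :
    IsHermitian (leftComplex (G := G) J hJ hN) g := fun x v w ↦ by
  rw [hg.inner_eq, hg.inner_eq]
  change metricOne g (leftTriv x (leftFrame x (J (leftTriv x v))))
    (leftTriv x (leftFrame x (J (leftTriv x w)))) = _
  rw [leftTriv_leftFrame, leftTriv_leftFrame, h]

/-! ### The flat connection is a Bismut connection -/

section Bismut

theorem contMDiffCovariantDerivative_flatConnection :
    (flatConnection n G).ContMDiffCovariantDerivative ∞ where
  contMDiff := {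
    contMDiff := by
      intro Y hY x _
      refine ContMDiffAt.contMDiffWithinAt ?_
      have hYx : SmoothFieldAt Y x :=
        (hY.contMDiffAt Filter.univ_mem).of_le (by simp)
      refine contMDiffAt_hom_of_leftFrame (F := EuclideanSpace ℝ (Fin n))
        (V := fun x : G ↦ TangentSpace (𝓡 n) x)
        (σ := fun x ↦ flatConnection n G Y x) fun u ↦ ?_
      exact contMDiffAt_leftFrame le_rfl (contMDiffAt_mvfderiv_apply (k := ∞)
        (by simpa using hYx.leftCoord) (smoothFieldAt_leftFrame u x)) }

theorem torsionForm_flatConnection {g : Metric n G} (hg : IsBiinvariant g) (x : G)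
    (u v w : TangentSpace (𝓡 n) x) :
    torsionForm g (flatConnection n G) x u v w =
      -metricOne g (leftTriv x u) (lieBr G (leftTriv x v) (leftTriv x w)) := by
  rw [torsionForm, torsion_flatConnection, map_neg, hg.inner_eq, leftTriv_leftFrame]

theorem IsBiinvariant.metricOne_symm {g : Metric n G} (u v : EuclideanSpace ℝ (Fin n)) :
    metricOne g u v = metricOne g v u :=
  g.symm 1 u v

/-- Constant coefficients make `J` and `g` parallel. The torsion form is skew in its first two slots
by invariance of the metric and in its last two by antisymmetry of the bracket. -/
theorem isBismut_flatConnection {g : Metric n G} {C : ComplexStructure n G}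
    (hg : IsBiinvariant g) (hC : IsLeftInvariant C) : IsBismut C g (flatConnection n G) where
  smooth := contMDiffCovariantDerivative_flatConnection
  parallel_J x Y hY v := by
    have h : leftCoord (fun y ↦ C.J y (Y y)) = fun y ↦ complexOne C (leftCoord Y y) :=
      funext fun y ↦ hC.leftTriv_J y (Y y)
    rw [flatConnection_apply, flatConnection_apply, h, hC.J_leftFrame,
      mvfderiv_clm_comp _ (mdifferentiableAt_leftCoord hY.mdifferentiableAt)]
  parallel_metric x Y Z hY hZ v := by
    have h : (fun y ↦ g.inner y (Y y) (Z y)) =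
        fun y ↦ metricOne g (leftCoord Y y) (leftCoord Z y) :=
      funext fun y ↦ hg.inner_eq y (Y y) (Z y)
    rw [h, mvfderiv_bilinear _ (mdifferentiableAt_leftCoord hY.mdifferentiableAt)
      (mdifferentiableAt_leftCoord hZ.mdifferentiableAt), hg.inner_eq, hg.inner_eq,
      flatConnection_apply, flatConnection_apply, leftTriv_leftFrame, leftTriv_leftFrame, add_comm]
    rfl
  skew_left x u v w := by
    rw [torsionForm_flatConnection hg, torsionForm_flatConnection hg]
    have h := lieBr_skew_of_coAd (G := G) (B := metricOne g) hg.metricOne_coAd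
    have s := IsBiinvariant.metricOne_symm (g := g)
    rw [← lieBr_skew (G := G) (leftTriv x v), ← lieBr_skew (G := G) (leftTriv x u), map_neg, map_neg,
      s, h, s]
  skew_right x u v w := by
    rw [torsionForm_flatConnection hg, torsionForm_flatConnection hg, ← lieBr_skew, map_neg]

end Bismut

/-! ### Uniqueness of the Bismut connection -/

section BismutUnique

/-- A trilinear form that is the connection form of a metric connection with totally skew torsion
and parallel complex structure vanishes. -/
theorem eq_zero_of_skew_of_complex {V : Type*} [AddCommGroup V] {a : V → V → V → ℝ} {J : V → V}
    (hJ : ∀ v, J (J v) = -v) (hneg : ∀ u v w, a (-u) v w = -a u v w)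
    (h₁ : ∀ u v w, a u v w = -a u w v)
    (h₂ : ∀ u v w, a u v w - a v u w = -(a u w v - a w u v))
    (h₃ : ∀ u v w, a u (J v) w = -a u v (J w)) (u v w : V) : a u v w = 0 := by
  -- Substituting `h₁` into `h₂` leaves antisymmetry in the outer slots, so `a` is alternating.
  have h₄ (u v w) : a u v w = -a v u w := by
    have := h₂ v u w
    have := h₁ v u w
    have := h₁ u v w
    have := h₁ w u v
    have := h₂ u v w
    have := h₂ w u v
    have := h₁ w v u
    linarith
  -- By `h₃` and alternation, `J` changes the sign whenever it moves to another slot. Taking it once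
  -- around the three slots gives `a (J u) v w = -a (J u) v w`.
  have h₅ (u v w) : a (J u) v w = 0 := by
    have := h₄ (J u) v w
    have := h₃ v u w
    have := h₄ v u (J w)
    have := h₁ (J u) v w
    have := h₄ (J u) w v
    have := h₃ w u v
    have := h₄ w u (J v)
    have := h₁ u w (J v)
    have := h₃ u v w
    linarith
  have := h₅ (J u) v w
  rw [hJ, hneg] at this
  linarith

/-- The derivative terms of two connections cancel in their difference, which is therefore a tensor
and sees only the value of the field at `x`. -/
theorem Connection.sub_eq_of_apply_eq {D D' : Connection n G} {Y Z : ∀ x : G, TangentSpace (𝓡 n) x}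
    {x : G} (hY : MDifferentiableAt (𝓡 n) (𝓡 n).tangent
      (fun y ↦ (⟨y, Y y⟩ : TangentBundle (𝓡 n) G)) x)
    (hZ : MDifferentiableAt (𝓡 n) (𝓡 n).tangent
      (fun y ↦ (⟨y, Z y⟩ : TangentBundle (𝓡 n) G)) x) (h : Y x = Z x) :
    D Y x - D' Y x = D Z x - D' Z x := by
  have h1 := IsCovariantDerivativeOn.difference_apply D.isCovariantDerivativeOnUniv
    D'.isCovariantDerivativeOnUniv (Set.mem_univ x) hY
  have h2 := IsCovariantDerivativeOn.difference_apply D.isCovariantDerivativeOnUniv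
    D'.isCovariantDerivativeOnUniv (Set.mem_univ x) hZ
  rw [← h1, ← h2, h]

/-- A connection annihilating the left-invariant fields is the flat connection. -/
theorem VanishesOnLeftInvariant.eq_flat {D : Connection n G} (hD : VanishesOnLeftInvariant D)
    {Y : ∀ x : G, TangentSpace (𝓡 n) x} {x : G} (hY : MDifferentiableAt (𝓡 n) (𝓡 n).tangent
      (fun y ↦ (⟨y, Y y⟩ : TangentBundle (𝓡 n) G)) x) :
    D Y x = flatConnection n G Y x := by
  have h := Connection.sub_eq_of_apply_eq (D := D) (D' := flatConnection n G) hY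
    (smoothFieldAt_leftFrame (leftTriv x (Y x)) x).mdifferentiableAt (leftFrame_leftTriv x _).symm
  have h0 : D (fun y : G ↦ leftFrame y (leftTriv x (Y x))) x = 0 := by
    ext v : 1
    have := hD (leftTriv x v) (leftTriv x (Y x)) x
    have e : mulInvariantVectorField (I := 𝓡 n) (leftTriv x v) x = v := leftFrame_leftTriv x v
    rw [e] at this
    exact this
  rw [h0, flatConnection_leftFrame, sub_zero] at h
  exact sub_eq_zero.1 h

theorem VanishesOnLeftInvariant.torsion_eq {D : Connection n G} (hD : VanishesOnLeftInvariant D)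
    (x : G) : D.torsion x = (flatConnection n G).torsion x := by
  ext u v : 2
  have hu := (smoothFieldAt_leftFrame (leftTriv x u) x).mdifferentiableAt
  have hv := (smoothFieldAt_leftFrame (leftTriv x v) x).mdifferentiableAt
  have h := D.torsion_apply hu hv
  have h' := (flatConnection n G).torsion_apply hu hv
  rw [hD.eq_flat hu, hD.eq_flat hv, ← h'] at h
  simpa using h

variable {g : Metric n G} {C : ComplexStructure n G} {D : Connection n G}

/-- The Bismut connection of a left-invariant Hermitian structure with bi-invariant metric
annihilates the left-invariant fields. -/
theorem IsBismut.vanishesOnLeftInvariant (hD : IsBismut C g D) (hg : IsBiinvariant g)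
    (hC : IsLeftInvariant C) (hH : IsHermitian C g) : VanishesOnLeftInvariant D := by
  intro u₀ v₀ x
  -- `Γ` is the difference between `D` and the flat connection at `x`, read in the Lie algebra.
  let Γ (u v : EuclideanSpace ℝ (Fin n)) : EuclideanSpace ℝ (Fin n) :=
    leftTriv x (D (fun y : G ↦ leftFrame y v) x (leftFrame x u))
  let B := metricOne g
  have hsm (v : EuclideanSpace ℝ (Fin n)) := smoothFieldAt_leftFrame (G := G) v x
  have symm := IsBiinvariant.metricOne_symm (g := g)
  have hJB (u v) : B (complexOne C u) v = -B u (complexOne C v) := by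
    have h := hH 1 u (complexOne C v)
    have e : complexOne C (complexOne C v) = -v := complexOne_complexOne C v
    have h' : B (complexOne C u) (complexOne C (complexOne C v)) = B u (complexOne C v) := h
    rw [e, map_neg] at h'
    linarith
  have hmet (u v w) : B (Γ u v) w = -B (Γ u w) v := by
    have h := hD.parallel_metric x _ _ (hsm v) (hsm w) (leftFrame x u)
    have e : (fun y : G ↦ g.inner y (leftFrame y v) (leftFrame y w)) = fun _ ↦ B v w := by
      ext1 y
      rw [hg.inner_eq, leftTriv_leftFrame, leftTriv_leftFrame]
    rw [e, hg.inner_eq, hg.inner_eq, leftTriv_leftFrame, leftTriv_leftFrame] at h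
    have h0 : mvfderiv (𝓡 n) (fun _ : G ↦ B v w) x = 0 := mvfderiv_const _
    rw [h0] at h
    have h2 : (0 : ℝ) = B (Γ u v) w + B v (Γ u w) := h
    rw [show B v (Γ u w) = B (Γ u w) v from symm _ _] at h2
    linarith
  have htor (u v w) : torsionForm g D x (leftFrame x w) (leftFrame x u) (leftFrame x v) =
      B w (Γ u v - Γ v u - lieBr G u v) := by
    rw [torsionForm, D.torsion_apply (hsm u).mdifferentiableAt (hsm v).mdifferentiableAt,
      hg.inner_eq, mlieBracket_leftFrame, leftTriv_leftFrame]
    refine congrArg (B w) ?_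
    rw [map_sub, map_sub, leftTriv_leftFrame]
  have hbr (u v w) : B w (lieBr G u v) = -B v (lieBr G u w) := by
    rw [← lieBr_skew_of_coAd (G := G) (B := metricOne g) hg.metricOne_coAd]
    exact symm _ _
  have hpar (u v) : Γ u (complexOne C v) = complexOne C (Γ u v) := by
    have h := hD.parallel_J x _ (hsm v) (leftFrame x u)
    have e : (fun y : G ↦ C.J y (leftFrame y v)) = fun y : G ↦ leftFrame y (complexOne C v) :=
      funext fun y ↦ hC.J_leftFrame y v
    rw [e] at h
    exact (congrArg (leftTriv x) h).trans (hC.leftTriv_J x _)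
  have key := eq_zero_of_skew_of_complex (a := fun u v w ↦ B (Γ u v) w) (J := complexOne C)
    (complexOne_complexOne C) (fun u v w ↦ by simp [Γ]) hmet (fun u v w ↦ by
      -- Skewness of the torsion under exchange of `v` and `w` is wanted for `Γ` alone. The bracket
      -- term is skew under this exchange by `hbr` and drops out.
      have h := hD.skew_left x (leftFrame x w) (leftFrame x u) (leftFrame x v)
      have h' := hD.skew_right x (leftFrame x v) (leftFrame x u) (leftFrame x w)
      have h'' := hD.skew_left x (leftFrame x v) (leftFrame x u) (leftFrame x w)
      have h''' := hD.skew_right x (leftFrame x u) (leftFrame x v) (leftFrame x w)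
      rw [htor, htor, map_sub, map_sub, map_sub, map_sub] at h h' h'' h'''
      have s1 := symm (Γ u v) w
      have s2 := symm (Γ v u) w
      have s3 := symm (Γ u w) v
      have s4 := symm (Γ w u) v
      have b1 := hbr u v w
      change (B (Γ u v) w : ℝ) - B (Γ v u) w = -(B (Γ u w) v - B (Γ w u) v)
      change B (Γ u v) w = _ at s1
      change B (Γ v u) w = _ at s2
      change B (Γ u w) v = _ at s3
      change B (Γ w u) v = _ at s4
      linarith) (fun u v w ↦ by
      rw [hpar, hJB])
  have hΓ : Γ u₀ v₀ = 0 := by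
    by_contra h
    exact (g.pos 1 (Γ u₀ v₀) h).ne' (key u₀ v₀ _)
  have := congrArg (leftFrame x) hΓ
  rw [leftFrame_leftTriv, map_zero] at this
  exact this

end BismutUnique

/-! ### Closed torsion, zero curvature, static metrics -/

section Consequences

variable {g : Metric n G} {C : ComplexStructure n G} {D : Connection n G}

/-- In left coordinates `c` has constant coefficients. The derivatives of the coordinates of the
`Xᵢ` cancel between the derivative and the bracket terms of `dc`; the remaining algebraic terms
vanish by the Jacobi identity. -/
theorem VanishesOnLeftInvariant.hasClosedTorsion (hD : VanishesOnLeftInvariant D)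
    (hg : IsBiinvariant g) : HasClosedTorsion g D := by
  intro x X₀ X₁ X₂ X₃ h₀ h₁ h₂ h₃
  let B := -metricOne g
  have hc (y : G) (u v w : TangentSpace (𝓡 n) y) : torsionForm g D y u v w =
      B (leftTriv y u) (lieBrL G (leftTriv y v) (leftTriv y w)) := by
    have h : torsionForm g D y u v w = torsionForm g (flatConnection n G) y u v w := by
      rw [torsionForm, torsionForm, hD.torsion_eq]
    rw [h, torsionForm_flatConnection hg]
    rfl
  have hs (u v : EuclideanSpace ℝ (Fin n)) : B u v = B v u := by
    simp [B, IsBiinvariant.metricOne_symm (g := g) u v]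
  have hinv (u v w : EuclideanSpace ℝ (Fin n)) : B u (lieBr G v w) = B v (lieBr G w u) := by
    have := lieBr_skew_of_coAd (G := G) (B := B) (fun x u v ↦ by
      simp [B, hg.metricOne_coAd x u v]) w v u
    rw [← lieBr_skew v w, map_neg, hs u, this, neg_neg]
  have hd {X Y Z : ∀ x : G, TangentSpace (𝓡 n) x} (hX : SmoothFieldAt X x)
      (hY : SmoothFieldAt Y x) (hZ : SmoothFieldAt Z x) (v : TangentSpace (𝓡 n) x) :
      mvfderiv (𝓡 n) (fun y ↦ torsionForm g D y (X y) (Y y) (Z y)) x v =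
        B (mvfderiv (𝓡 n) (leftCoord Z) x v) (lieBr G (leftCoord X x) (leftCoord Y x)) -
        B (mvfderiv (𝓡 n) (leftCoord Y) x v) (lieBr G (leftCoord X x) (leftCoord Z x)) +
        B (mvfderiv (𝓡 n) (leftCoord X) x v) (lieBr G (leftCoord Y x) (leftCoord Z x)) := by
    have hX' := mdifferentiableAt_leftCoord hX.mdifferentiableAt
    have hY' := mdifferentiableAt_leftCoord hY.mdifferentiableAt
    have hZ' := mdifferentiableAt_leftCoord hZ.mdifferentiableAt
    have e : (fun y ↦ torsionForm g D y (X y) (Y y) (Z y)) =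
        fun y ↦ B (leftCoord X y) (lieBrL G (leftCoord Y y) (leftCoord Z y)) :=
      funext fun y ↦ hc y _ _ _
    rw [e, mvfderiv_bilinear B hX' (mdifferentiableAt_bilinear (lieBrL G) hY' hZ'),
      mvfderiv_bilinear (lieBrL G) hY' hZ', map_add, lieBrL_apply, lieBrL_apply, lieBrL_apply,
      hinv (leftCoord X x) (leftCoord Y x), hinv (leftCoord Y x),
      hinv (leftCoord X x) (mvfderiv (𝓡 n) (leftCoord Y) x v), ← lieBr_skew (leftCoord Z x),
      map_neg, ← sub_eq_add_neg]
  have hbr {X Y : ∀ x : G, TangentSpace (𝓡 n) x} (hX : SmoothFieldAt X x)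
      (hY : SmoothFieldAt Y x) (Z W : ∀ x : G, TangentSpace (𝓡 n) x) :
      torsionForm g D x (mlieBracket (𝓡 n) X Y x) (Z x) (W x) =
        B (mvfderiv (𝓡 n) (leftCoord Y) x (X x)) (lieBr G (leftCoord Z x) (leftCoord W x)) -
        B (mvfderiv (𝓡 n) (leftCoord X) x (Y x)) (lieBr G (leftCoord Z x) (leftCoord W x)) +
        B (lieBr G (leftCoord X x) (leftCoord Y x)) (lieBr G (leftCoord Z x) (leftCoord W x)) := by
    rw [hc, leftTriv_mlieBracket hX.mdifferentiableAt hY.mdifferentiableAt]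
    simp [leftCoord]
  -- Invariance isolates `z`, and the sum becomes `B z` applied to a Jacobi sum in `u`, `v`, `w`.
  have hjac (u v w z : EuclideanSpace ℝ (Fin n)) :
      B (lieBr G u v) (lieBr G w z) - B (lieBr G u w) (lieBr G v z) +
        B (lieBr G u z) (lieBr G v w) = 0 := by
    have hjac₀ : lieBr G (lieBr G u v) w - lieBr G (lieBr G u w) v + lieBr G (lieBr G v w) u = 0 := by
      rw [← lieBr_skew (lieBr G u w), ← lieBr_skew (lieBr G v w), lieBr_jacobi u v w]
      abel
    rw [hinv _ w z, hinv w, hinv _ v z, hinv v, hs (lieBr G u z), hinv _ u z, hinv u, ← map_sub,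
      ← map_add, hjac₀, map_zero]
  rw [extDerivThree, hd h₁ h₂ h₃, hd h₀ h₂ h₃, hd h₀ h₁ h₃, hd h₀ h₁ h₂, hbr h₀ h₁, hbr h₀ h₂,
    hbr h₀ h₃, hbr h₁ h₂, hbr h₁ h₃, hbr h₂ h₃]
  have := hjac (leftCoord X₀ x) (leftCoord X₁ x) (leftCoord X₂ x) (leftCoord X₃ x)
  have s₁ := hs (lieBr G (leftCoord X₁ x) (leftCoord X₂ x)) (lieBr G (leftCoord X₀ x) (leftCoord X₃ x))
  have s₂ := hs (lieBr G (leftCoord X₁ x) (leftCoord X₃ x)) (lieBr G (leftCoord X₀ x) (leftCoord X₂ x))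
  have s₃ := hs (lieBr G (leftCoord X₂ x) (leftCoord X₃ x)) (lieBr G (leftCoord X₀ x) (leftCoord X₁ x))
  linarith

/-- Covariant differentiation is differentiation of left coordinates, so the curvature is the
discrepancy between the bracket and the commutator of derivations, which is zero. -/
theorem VanishesOnLeftInvariant.curvature_eq_zero (hD : VanishesOnLeftInvariant D)
    {X Y Z : ∀ x : G, TangentSpace (𝓡 n) x} {x : G} (hX : SmoothFieldAt X x)
    (hY : SmoothFieldAt Y x) (hZ : SmoothFieldAt Z x) : curvature D X Y Z x = 0 := by
  have hZ' : ∀ᶠ y in 𝓝 x, ContMDiffAt (𝓡 n) (𝓡 n).tangent 1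
      (fun y ↦ (⟨y, Z y⟩ : TangentBundle (𝓡 n) G)) y :=
    (contMDiffAt_iff_contMDiffAt_nhds (by simp)).1 (ContMDiffAt.of_le hZ (by simp))
  have hd {Y : ∀ x : G, TangentSpace (𝓡 n) x} (hY : SmoothFieldAt Y x) (v : TangentSpace (𝓡 n) x) :
      D (fun y ↦ D Z y (Y y)) x v =
        leftFrame x (mvfderiv (𝓡 n) (fun y ↦ mvfderiv (𝓡 n) (leftCoord Z) y (Y y)) x v) := by
    have hev : ∀ᶠ y in 𝓝 x, D Z y (Y y) =
        leftFrame y (mvfderiv (𝓡 n) (leftCoord Z) y (Y y)) := by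
      filter_upwards [hZ'] with y hy
      rw [hD.eq_flat (hy.mdifferentiableAt (by simp)), flatConnection_apply]
    have hs : MDifferentiableAt (𝓡 n) (𝓡 n).tangent
        (fun y ↦ (⟨y, leftFrame y (mvfderiv (𝓡 n) (leftCoord Z) y (Y y))⟩ :
          TangentBundle (𝓡 n) G)) x :=
      (contMDiffAt_leftFrame le_rfl (contMDiffAt_mvfderiv_apply (k := ∞)
        (by simpa using hZ.leftCoord) hY)).mdifferentiableAt (by simp)
    have hs' : MDifferentiableAt (𝓡 n) (𝓡 n).tangent
        (fun y ↦ (⟨y, D Z y (Y y)⟩ : TangentBundle (𝓡 n) G)) x :=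
      hs.congr_of_eventuallyEq (hev.mono fun y hy ↦ by simp only [hy])
    -- The flat formula for `D Z` is known only near `x`, where `Z` is differentiable; a connection
    -- is local, which is enough.
    rw [D.isCovariantDerivativeOnUniv.congr_of_eventuallyEq hs' hs Filter.univ_mem hev,
      hD.eq_flat hs, flatConnection_apply, leftCoord_leftFrame]
  rw [curvature, hd hX, hd hY, hD.eq_flat hZ.mdifferentiableAt, flatConnection_apply,
    mvfderiv_mlieBracket hZ.leftCoord hX hY, map_sub, sub_self]

theorem VanishesOnLeftInvariant.ricciForm_eq_zero (hD : VanishesOnLeftInvariant D)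
    {e : Fin n → ∀ x : G, TangentSpace (𝓡 n) x} {X Y : ∀ x : G, TangentSpace (𝓡 n) x} {x : G}
    (he : IsOrthonormalFrameAt g e x) (hX : SmoothFieldAt X x) (hY : SmoothFieldAt Y x) :
    ricciForm C g D e X Y x = 0 := by
  rw [ricciForm, Finset.sum_eq_zero, mul_zero]
  intro k _
  rw [hD.curvature_eq_zero hX hY (he.1 k), map_zero]
  rfl

theorem IsBiinvariant.isSKT (hg : IsBiinvariant g) (hC : IsLeftInvariant C)
    (hH : IsHermitian C g) : IsSKT C g :=
  have hB := isBismut_flatConnection hg hC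
  ⟨hH, _, hB, (hB.vanishesOnLeftInvariant hg hC hH).hasClosedTorsion hg⟩

theorem IsBiinvariant.isStatic (hg : IsBiinvariant g) (hC : IsLeftInvariant C)
    (hH : IsHermitian C g) : IsStatic C g 0 := by
  have hB := isBismut_flatConnection hg hC
  have hV := hB.vanishesOnLeftInvariant hg hC hH
  have hJ {X : ∀ x : G, TangentSpace (𝓡 n) x} {x : G} (hX : SmoothFieldAt X x) :
      SmoothFieldAt (fun y ↦ C.J y (X y)) x := by
    have : (fun y ↦ C.J y (X y)) = fun y ↦ leftFrame y (complexOne C (leftCoord X y)) := by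
      ext1 y
      rw [← hC.J_leftFrame, leftFrame_leftCoord]
    rw [this]
    exact contMDiffAt_leftFrame le_rfl
      ((complexOne C).contMDiff.contMDiffAt.comp x hX.leftCoord)
  refine ⟨hg.isSKT hC hH, _, hB, fun x e X Y he hX hY ↦ ?_⟩
  rw [ricciFormOneOne, hV.ricciForm_eq_zero he hX hY, hV.ricciForm_eq_zero he (hJ hX) (hJ hY)]
  simp

end Consequences

/-! ### Averaging over Haar measure -/

section Averaging

open MeasureTheory

variable [CompactSpace G] [T2Space G]

theorem continuous_coAd_apply (v : EuclideanSpace ℝ (Fin n)) :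
    Continuous fun x : G ↦ coAd x v :=
  (contMDiff_coAd v).continuous

variable (n G) in
/-- The Lie algebra of a compact Lie group carries an inner product invariant under the adjoint
representation. -/
theorem exists_invariant_inner :
    ∃ B : EuclideanSpace ℝ (Fin n) →L[ℝ] EuclideanSpace ℝ (Fin n) →L[ℝ] ℝ,
      (∀ u v, B u v = B v u) ∧ (∀ v, v ≠ 0 → 0 < B v v) ∧
      ∀ (x : G) u v, B (coAd x u) (coAd x v) = B u v := by
  have : IsTopologicalGroup G := topologicalGroup_of_lieGroup (𝓡 n) ∞
  let _ : MeasurableSpace G := borel G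
  have : BorelSpace G := ⟨rfl⟩
  let μ : Measure G := Measure.haar
  have hc (u v : EuclideanSpace ℝ (Fin n)) : Continuous fun a : G ↦ inner ℝ (coAd a u) (coAd a v) :=
    (continuous_coAd_apply u).inner (continuous_coAd_apply v)
  have hi (u v : EuclideanSpace ℝ (Fin n)) :
      Integrable (fun a : G ↦ inner ℝ (coAd a u) (coAd a v)) μ :=
    (hc u v).integrable_of_hasCompactSupport (HasCompactSupport.of_compactSpace _)
  let B := (LinearMap.mk₂ ℝ (fun u v ↦ ∫ a, inner ℝ (coAd a u) (coAd a v) ∂μ)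
    (fun u u' v ↦ by
      simp_rw [map_add, inner_add_left]
      exact integral_add (hi u v) (hi u' v))
    (fun c u v ↦ by
      simp_rw [map_smul, real_inner_smul_left]
      exact integral_const_mul c _)
    (fun u v v' ↦ by
      simp_rw [map_add, inner_add_right]
      exact integral_add (hi u v) (hi u v'))
    (fun c u v ↦ by
      simp_rw [map_smul, real_inner_smul_right]
      exact integral_const_mul c _)).toContinuousBilinearMap
  have hB (u v) : B u v = ∫ a, inner ℝ (coAd a u) (coAd a v) ∂μ := rfl
  refine ⟨B, fun u v ↦ ?_, fun v hv ↦ ?_, fun x u v ↦ ?_⟩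
  · simp_rw [hB, real_inner_comm]
  · rw [hB]
    refine (hc v v).integral_pos_of_hasCompactSupport_nonneg_nonzero
      (HasCompactSupport.of_compactSpace _) (fun a ↦ real_inner_self_nonneg) (x := 1) ?_
    rw [coAd_one]
    simpa using hv
  -- `coAd` is a right action, so applying `coAd x` left-translates the integrand by `x`.
  · simp_rw [hB, ← coAd_mul]
    exact integral_mul_left_eq_self (fun a ↦ inner ℝ (coAd a u) (coAd a v)) x

end Averaging

/-! ### The adjoint action by Lie algebra automorphisms -/

section Adjoint

/-- Conjugation `b ↦ a⁻¹ * (b * a)` fixes `1`, and its differential there is `coAd a` by definition;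
the rest is the chain rule. -/
theorem mvfderiv_conj (a : G) {F : Type*} [NormedAddCommGroup F] [NormedSpace ℝ F] {f : G → F}
    (hf : MDifferentiableAt (𝓡 n) 𝓘(ℝ, F) f 1) (u : EuclideanSpace ℝ (Fin n)) :
    mvfderiv (𝓡 n) (fun b ↦ f (a⁻¹ * (b * a))) 1 u = mvfderiv (𝓡 n) f 1 (coAd a u) := by
  have ha : a⁻¹ * a = 1 := inv_mul_cancel a
  have h₁ : MDifferentiableAt (𝓡 n) (𝓡 n) (fun b : G ↦ a⁻¹ * b) a :=
    mdifferentiableAt_leftMul a⁻¹ a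
  have hf' : MDifferentiableAt (𝓡 n) 𝓘(ℝ, F) f (a⁻¹ * a) := by rwa [ha]
  have h₂ : MDifferentiableAt (𝓡 n) 𝓘(ℝ, F) (f ∘ fun b : G ↦ a⁻¹ * b) a :=
    hf'.comp a h₁
  have h₃ := mfderiv_comp_apply_of_eq (I := 𝓡 n) (I' := 𝓡 n) (g := f ∘ fun b : G ↦ a⁻¹ * b)
    (f := fun z ↦ z * a) (x := 1) h₂ (mdifferentiableAt_rightMul a 1) (one_mul a) u
  have h₄ := mfderiv_comp_apply_of_eq (I := 𝓡 n) (I' := 𝓡 n) (g := f) (f := fun b : G ↦ a⁻¹ * b)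
    (x := a) hf h₁ ha (rightFrame a u)
  exact h₃.trans h₄

/-- Since `coAd (a⁻¹ * (b * a)) (coAd a v) = coAd a (coAd b v)`, differentiating both sides in `b`
at `1` gives the claim. -/
theorem coAd_lieBr (a : G) (u v : EuclideanSpace ℝ (Fin n)) :
    coAd a (lieBr G u v) = lieBr G (coAd a u) (coAd a v) := by
  have hc (v : EuclideanSpace ℝ (Fin n)) : MDifferentiableAt (𝓡 n)
      𝓘(ℝ, EuclideanSpace ℝ (Fin n)) (fun x : G ↦ coAd x v) 1 :=
    (contMDiff_coAd v).contMDiffAt.mdifferentiableAt (by simp)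
  have h := mvfderiv_conj a (hc (coAd a v)) u
  have e : (fun b : G ↦ coAd (a⁻¹ * (b * a)) (coAd a v)) = fun b ↦ coAd a (coAd b v) := by
    ext1 b
    rw [coAd_mul, coAd_inv_coAd, coAd_mul]
  rw [e] at h
  have h' := (mvfderiv_clm_comp (coAd a) (hc v) u).symm.trans h
  rw [mvfderiv_coAd, mvfderiv_coAd, map_neg, neg_inj] at h'
  exact h'

/-- The adjoint representation acts by automorphisms of the Lie algebra. -/
def coAdEquiv (a : G) : GroupLieAlgebra (𝓡 n) G ≃ₗ⁅ℝ⁆ GroupLieAlgebra (𝓡 n) G :=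
  { (coAd a).toLinearMap with
    map_lie' := coAd_lieBr a _ _
    invFun := coAd a⁻¹
    left_inv := coAd_inv_coAd a
    right_inv := coAd_coAd_inv a }

end Adjoint

/-! ### Negativity of the Killing form -/

section Killing

/-- The inner product space structure given by a positive definite symmetric bilinear form. -/
@[reducible]
def innerCoreOfBilin {V : Type*} [AddCommGroup V] [Module ℝ V] (B : V →ₗ[ℝ] V →ₗ[ℝ] ℝ)
    (hsymm : ∀ u v, B u v = B v u) (hpos : ∀ v, v ≠ 0 → 0 < B v v) :
    InnerProductSpace.Core ℝ V where
  inner u v := B u v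
  conj_inner_symm u v := hsymm v u
  re_inner_nonneg v := by
    rcases eq_or_ne v 0 with rfl | hv
    · simp
    · exact (hpos v hv).le
  add_left u v w := by simp
  smul_left u v c := by simp
  definite v hv := by
    by_contra h
    exact (hpos v h).ne' hv

/-- In a basis orthonormal for `B` the trace is minus the sum of the squared norms of the vectors `A
(b i)`. -/
theorem trace_comp_self_neg_of_skew {V : Type*} [AddCommGroup V] [Module ℝ V]
    [FiniteDimensional ℝ V] (B : V →ₗ[ℝ] V →ₗ[ℝ] ℝ) (hsymm : ∀ u v, B u v = B v u)
    (hpos : ∀ v, v ≠ 0 → 0 < B v v) {A : V →ₗ[ℝ] V} (hA : ∀ u v, B (A u) v = -B u (A v))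
    (h0 : A ≠ 0) : LinearMap.trace ℝ V (A ∘ₗ A) < 0 := by
  let core := innerCoreOfBilin B hsymm hpos
  let _ : NormedAddCommGroup V := core.toNormedAddCommGroup
  let _ : InnerProductSpace ℝ V := InnerProductSpace.ofCore core.toCore
  let b := stdOrthonormalBasis ℝ V
  have hb (i) : inner ℝ (b i) ((A ∘ₗ A) (b i)) = -‖A (b i)‖ ^ 2 := by
    rw [← real_inner_self_eq_norm_sq]
    have h : B (A (b i)) (A (b i)) = -B (b i) (A (A (b i))) := hA _ _
    exact (neg_eq_iff_eq_neg.2 h).symm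
  rw [LinearMap.trace_eq_sum_inner _ b, Finset.sum_congr rfl fun i _ ↦ hb i,
    Finset.sum_neg_distrib, neg_lt_zero]
  by_contra h
  refine h0 (b.toBasis.ext fun i ↦ ?_)
  have h' := (Finset.sum_eq_zero_iff_of_nonneg fun i _ ↦ sq_nonneg ‖A (b i)‖).1
    (le_antisymm (not_lt.1 h) (Finset.sum_nonneg fun i _ ↦ sq_nonneg ‖A (b i)‖)) i
    (Finset.mem_univ i)
  simpa using h'

/-- `ad v` is skew for `B`, and it is nonzero because a trivial radical leaves no center. -/
theorem killingForm_neg_of_invariant {L : Type*} [LieRing L] [LieAlgebra ℝ L]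
    [FiniteDimensional ℝ L] [LieAlgebra.HasTrivialRadical ℝ L] (B : L →ₗ[ℝ] L →ₗ[ℝ] ℝ)
    (hsymm : ∀ u v, B u v = B v u) (hpos : ∀ v, v ≠ 0 → 0 < B v v)
    (hB : ∀ u v w : L, B ⁅u, v⁆ w = -B v ⁅u, w⁆) {v : L} (hv : v ≠ 0) : killingForm ℝ L v v < 0 := by
  rw [killingForm_apply_apply]
  refine trace_comp_self_neg_of_skew B hsymm hpos (fun u w ↦ hB v u w) fun h ↦ hv ?_
  have : v ∈ LieAlgebra.center ℝ L := by
    rw [LieModule.mem_maxTrivSubmodule]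
    intro x
    rw [← lie_skew, neg_eq_zero]
    exact LinearMap.congr_fun h x
  rwa [LieAlgebra.center_eq_bot, LieSubmodule.mem_bot] at this

variable [CompactSpace G] [T2Space G]

variable (n G) in
theorem exists_isBiinvariant : ∃ g : Metric n G, IsBiinvariant g := by
  obtain ⟨B, hs, hp, hB⟩ := exists_invariant_inner n G
  exact ⟨leftMetric B hs hp, isBiinvariant_leftMetric hs hp hB⟩

/-- A bilinear form on the model space as a form on the Lie algebra of `G`. -/
def algebraForm (B : EuclideanSpace ℝ (Fin n) →L[ℝ] EuclideanSpace ℝ (Fin n) →L[ℝ] ℝ) :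
    GroupLieAlgebra (𝓡 n) G →ₗ[ℝ] GroupLieAlgebra (𝓡 n) G →ₗ[ℝ] ℝ :=
  (LinearMap.mk₂ ℝ (fun u v ↦ B u v) (fun u v w ↦ by simp) (fun c u v ↦ by simp)
    (fun u v w ↦ by simp) (fun c u v ↦ by simp) :
    EuclideanSpace ℝ (Fin n) →ₗ[ℝ] EuclideanSpace ℝ (Fin n) →ₗ[ℝ] ℝ)

instance : FiniteDimensional ℝ (GroupLieAlgebra (𝓡 n) G) :=
  inferInstanceAs (FiniteDimensional ℝ (EuclideanSpace ℝ (Fin n)))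

theorem exists_isInducedByKillingForm
    (h : LieAlgebra.IsSemisimple ℝ (GroupLieAlgebra (𝓡 n) G)) :
    ∃ g : Metric n G, IsBiinvariant g ∧ IsInducedByKillingForm g := by
  obtain ⟨B, hs, hp, hB⟩ := exists_invariant_inner n G
  let K : EuclideanSpace ℝ (Fin n) →L[ℝ] EuclideanSpace ℝ (Fin n) →L[ℝ] ℝ :=
    LinearMap.toContinuousBilinearMap (-killingForm ℝ (GroupLieAlgebra (𝓡 n) G))
  have hK (u v : GroupLieAlgebra (𝓡 n) G) :
      K u v = -killingForm ℝ (GroupLieAlgebra (𝓡 n) G) u v := rfl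
  have hKs (u v : EuclideanSpace ℝ (Fin n)) : K u v = K v u :=
    congrArg Neg.neg (LieModule.traceForm_comm ℝ (GroupLieAlgebra (𝓡 n) G)
      (GroupLieAlgebra (𝓡 n) G) u v)
  have hKp (v : EuclideanSpace ℝ (Fin n)) (hv : v ≠ 0) : 0 < K v v :=
    neg_pos.2 (killingForm_neg_of_invariant (L := GroupLieAlgebra (𝓡 n) G) (algebraForm B) hs hp
      (fun u v w ↦ lieBr_skew_of_coAd (G := G) hB u v w) hv)
  refine ⟨leftMetric K hKs hKp, isBiinvariant_leftMetric hKs hKp fun x u v ↦ ?_,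
    fun v w ↦ leftMetric_inner_one hKs hKp v w⟩
  -- Automorphisms preserve the Killing form, so invariance under `coAd` is automatic.
  exact congrArg Neg.neg (LieAlgebra.killingForm_of_equiv_apply (coAdEquiv x) u v)

end Killing

/-! ### Skew maps and orthogonal complex structures -/

section SkewMaps

open Module

variable {V : Type*} [NormedAddCommGroup V] [InnerProductSpace ℝ V] [FiniteDimensional ℝ V]

/-- Transposition preserves the determinant, while negation changes its sign in odd dimension. -/
theorem det_eq_zero_of_skew_of_odd {A : V →ₗ[ℝ] V}
    (hA : ∀ u v, inner ℝ (A u) v = -inner ℝ u (A v)) (hodd : Odd (finrank ℝ V)) :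
    LinearMap.det A = 0 := by
  let b := stdOrthonormalBasis ℝ V
  have hM : (LinearMap.toMatrix b.toBasis b.toBasis A).transpose =
      -LinearMap.toMatrix b.toBasis b.toBasis A := by
    ext i j
    have h₁ := LinearMap.toMatrix_apply b.toBasis b.toBasis A j i
    have h₂ := LinearMap.toMatrix_apply b.toBasis b.toBasis A i j
    rw [OrthonormalBasis.coe_toBasis_repr_apply, OrthonormalBasis.repr_apply_apply] at h₁ h₂
    rw [Matrix.transpose_apply, Matrix.neg_apply, h₁, h₂, OrthonormalBasis.coe_toBasis,
      ← hA, real_inner_comm]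
  have h := congrArg Matrix.det hM
  rw [Matrix.det_transpose, Matrix.det_neg, Fintype.card_fin, hodd.neg_one_pow,
    LinearMap.det_toMatrix] at h
  linarith

/-- The kernel of a skew map has the same parity as the space. -/
theorem even_finrank_ker_of_skew {A : V →ₗ[ℝ] V}
    (hA : ∀ u v, inner ℝ (A u) v = -inner ℝ u (A v)) (hev : Even (finrank ℝ V)) :
    Even (finrank ℝ (LinearMap.ker A)) := by
  let K := LinearMap.ker A
  have hmap : ∀ v ∈ Kᗮ, A v ∈ Kᗮ := fun v _ ↦ by
    rw [Submodule.mem_orthogonal]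
    intro u hu
    rw [← neg_eq_zero, ← hA, LinearMap.mem_ker.1 hu, inner_zero_left]
  have hinj : Function.Injective (A.restrict hmap) := by
    rw [← LinearMap.ker_eq_bot, LinearMap.ker_eq_bot']
    intro v hv
    have hv' : (v : V) ∈ K := LinearMap.mem_ker.2 (congrArg Subtype.val hv)
    exact Subtype.ext (inner_self_eq_zero.1 ((Submodule.mem_orthogonal _ _).1 v.2 v hv'))
  -- `A` is injective on `Kᗮ`, so its determinant there is nonzero and the dimension cannot be odd.
  have hK : Even (finrank ℝ Kᗮ) := by
    by_contra hodd
    have h0 := det_eq_zero_of_skew_of_odd (A := A.restrict hmap)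
      (fun u v ↦ hA u v) (Nat.not_even_iff_odd.1 hodd)
    have := (LinearMap.isUnit_iff_isUnit_det _).1
      ((LinearMap.isUnit_iff_ker_eq_bot _).2 (LinearMap.ker_eq_bot.2 hinj))
    rw [h0] at this
    exact not_isUnit_zero this
  rw [← K.finrank_add_finrank_orthogonal, Nat.even_add] at hev
  exact hev.2 hK

/-- An even-dimensional Euclidean space has an orthogonal complex structure. -/
theorem exists_orthogonal_complex (hev : Even (finrank ℝ V)) :
    ∃ J : V →ₗ[ℝ] V, (∀ v, J (J v) = -v) ∧ ∀ u v, inner ℝ (J u) v = -inner ℝ u (J v) := by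
  obtain ⟨m, hm⟩ := hev
  let b : OrthonormalBasis (Fin m ⊕ Fin m) ℝ V :=
    (stdOrthonormalBasis ℝ V).reindex ((finCongr hm).trans finSumFinEquiv.symm)
  let J : V →ₗ[ℝ] V := b.toBasis.constr ℝ
    (Sum.elim (fun i ↦ b (.inr i)) fun i ↦ -b (.inl i))
  have hl (i) : J (b (.inl i)) = b (.inr i) := by
    have := b.toBasis.constr_basis ℝ (Sum.elim (fun i ↦ b (.inr i)) fun i ↦ -b (.inl i)) (.inl i)
    rwa [OrthonormalBasis.coe_toBasis] at this
  have hr (i) : J (b (.inr i)) = -b (.inl i) := by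
    have := b.toBasis.constr_basis ℝ (Sum.elim (fun i ↦ b (.inr i)) fun i ↦ -b (.inl i)) (.inr i)
    rwa [OrthonormalBasis.coe_toBasis] at this
  have h₁ : J ∘ₗ J = -LinearMap.id := by
    refine b.toBasis.ext fun i ↦ ?_
    rcases i with i | i <;> simp [hl, hr]
  have h₂ : (innerₗ V) ∘ₗ J = -(innerₗ V).compl₂ J := by
    refine LinearMap.ext_basis b.toBasis b.toBasis fun i j ↦ ?_
    have ho := orthonormal_iff_ite.1 b.orthonormal
    rcases i with i | i <;> rcases j with j | j <;> simp [hl, hr, ho]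
  exact ⟨J, fun v ↦ LinearMap.congr_fun h₁ v, fun u v ↦ LinearMap.congr_fun₂ h₂ u v⟩

theorem isSymmetric_aeval {S : V →ₗ[ℝ] V} (hS : S.IsSymmetric) (p : Polynomial ℝ) :
    (Polynomial.aeval S p).IsSymmetric := by
  induction p using Polynomial.induction_on' with
  | add p q hp hq => rw [map_add]; exact hp.add hq
  | monomial k c =>
    intro u v
    have := hS.pow k u v
    simp only [Polynomial.aeval_monomial, Module.algebraMap_end_eq_smul_id, Module.End.mul_apply,
      LinearMap.smul_apply, LinearMap.id_apply, real_inner_smul_left, real_inner_smul_right, this]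

/-- The orthogonal part of a skew map `A` of an even-dimensional Euclidean space, extended to the
kernel of `A` by an orthogonal complex structure. -/
theorem exists_complex_of_skew (hev : Even (finrank ℝ V)) {A : V →ₗ[ℝ] V}
    (hA : ∀ u v, inner ℝ (A u) v = -inner ℝ u (A v)) :
    ∃ (J : V →ₗ[ℝ] V) (b : Basis (Fin (finrank ℝ V)) ℝ V), (∀ v, J (J v) = -v) ∧
      (∀ u v, inner ℝ (J u) v = -inner ℝ u (J v)) ∧ (∀ v, A v = 0 → A (J v) = 0) ∧
      (∀ a : ℝ, 0 < a → ∀ v, A (A v) = -(a ^ 2) • v → a • J v = A v) ∧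
      (∀ i, ∃ a : ℝ, 0 ≤ a ∧ A (A (b i)) = -(a ^ 2) • b i) ∧
      (∀ T : V →ₗ[ℝ] V, (∀ v, T (A v) = A (T v)) → (∀ v, A v = 0 → T v = 0) →
        (∀ u v, inner ℝ (T u) v = -inner ℝ u (T v)) → ∀ v, J (T v) = T (J v)) := by
  let S : V →ₗ[ℝ] V := -(A ∘ₗ A)
  have hSA (v : V) : S v = -A (A v) := rfl
  have hS : S.IsSymmetric := fun u v ↦ by
    rw [hSA, hSA, inner_neg_left, inner_neg_right, hA, hA, neg_neg]
  let b := hS.eigenvectorBasis rfl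
  let s : Finset ℝ := Finset.univ.image (hS.eigenvalues rfl)
  -- `R = q(S)` plays the role of `S^(-1/2)`: it is `1 / a` on the eigenspace for `a² > 0`. Being a
  -- polynomial in `S`, it is symmetric and commutes with whatever commutes with `A`. The value at
  -- `0` is irrelevant, as `A ∘ R` vanishes on `ker A` anyway.
  let q : Polynomial ℝ := Lagrange.interpolate s id fun x ↦ (Real.sqrt x)⁻¹
  let R : V →ₗ[ℝ] V := Polynomial.aeval S q
  have hR (a : ℝ) (ha : 0 < a) (v : V) (hv : A (A v) = -(a ^ 2) • v) : a • R v = v := by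
    rcases eq_or_ne v 0 with rfl | hv0
    · simp
    have hSv : S v = a ^ 2 • v := by rw [hSA, hv, neg_smul, neg_neg]
    have hmem : a ^ 2 ∈ s := by
      obtain ⟨i, hi⟩ := hS.exists_eigenvalues_eq rfl
        (Module.End.hasEigenvalue_of_hasEigenvector ⟨Module.End.mem_eigenspace_iff.2 hSv, hv0⟩)
      exact Finset.mem_image.2 ⟨i, Finset.mem_univ i, hi⟩
    have := Module.End.aeval_apply_of_mem_apply_eq_smul (p := q) hSv
    have hq : q.eval (a ^ 2) = a⁻¹ := by
      have := Lagrange.eval_interpolate_at_node (s := s) (v := id) (fun x ↦ (Real.sqrt x)⁻¹)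
        Function.injective_id.injOn hmem
      rwa [Real.sqrt_sq ha.le] at this
    rw [hq] at this
    change a • Polynomial.aeval S q v = v
    rw [this, smul_smul, mul_inv_cancel₀ ha.ne', one_smul]
  have hRT (T : V →ₗ[ℝ] V) (hT : ∀ v, T (A v) = A (T v)) (v : V) : T (R v) = R (T v) := by
    have hc : Commute S T := by
      ext v : 1
      change -A (A (T v)) = T (-A (A v))
      rw [map_neg, hT, hT]
    have hc' : Commute R T := by
      have := (Algebra.commute_of_mem_adjoin_singleton_of_commute
        (Polynomial.aeval_mem_adjoin_singleton ℝ S (p := q)) hc.symm)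
      exact this.symm
    exact (LinearMap.congr_fun hc'.eq v).symm
  have hRA := hRT A fun _ ↦ rfl
  have hRs : R.IsSymmetric := isSymmetric_aeval hS q
  let K := LinearMap.ker A
  obtain ⟨j, hj, hjs⟩ := exists_orthogonal_complex (even_finrank_ker_of_skew hA hev)
  let P : V →ₗ[ℝ] K := K.orthogonalProjectionOnto.toLinearMap
  have hPK (k : K) : P k = k := K.orthogonalProjectionOnto_mem_subspace_eq_self k
  have hP (v : V) (k : K) : inner ℝ v (k : V) = inner ℝ (P v) k :=
    (K.inner_orthogonalProjectionOnto_eq_of_mem_right k v).symm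
  -- A skew map that kills `ker A` has its image orthogonal to `ker A`.
  have hP0 (T : V →ₗ[ℝ] V) (h : ∀ v, A v = 0 → T v = 0)
      (hT : ∀ u v, inner ℝ (T u) v = -inner ℝ u (T v)) (v : V) : P (T v) = 0 := by
    rw [← inner_self_eq_zero (𝕜 := ℝ), ← hP, hT, h _ (P (T v)).2, inner_zero_right, neg_zero]
  -- The polar part of `A` off its kernel, plus the auxiliary structure `j` on the kernel.
  let J : V →ₗ[ℝ] V := A ∘ₗ R + K.subtype ∘ₗ j ∘ₗ P
  have hJ (v : V) : J v = A (R v) + j (P v) := rfl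
  have hJA (a : ℝ) (ha : 0 < a) (v : V) (hv : A (A v) = -(a ^ 2) • v) : a • J v = A v := by
    have hPv : P v = 0 := by
      have : a ^ 2 • P v = 0 := by
        rw [← neg_eq_zero, ← neg_smul, ← map_smul, ← hv, hP0 A (fun _ h ↦ h) hA]
      exact (smul_eq_zero.1 this).resolve_left (by positivity)
    rw [hJ, hPv, map_zero, ZeroMemClass.coe_zero, add_zero, ← map_smul, hR a ha v hv]
  have hJK (v : V) (hv : A v = 0) : J v = j (P v) := by
    rw [hJ, hRA, hv, map_zero, zero_add]
  have hb (i) : ∃ a : ℝ, 0 ≤ a ∧ A (A (b i)) = -(a ^ 2) • b i := by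
    have h := hS.apply_eigenvectorBasis rfl i
    set c := hS.eigenvalues rfl i with hc
    have hSb : S (b i) = c • b i := h
    have h0 : 0 ≤ c := by
      have e : inner ℝ (S (b i)) (b i) = c * inner ℝ (b i) (b i) := by
        rw [hSb, real_inner_smul_left]
      rw [hSA, inner_neg_left, hA, neg_neg, real_inner_self_eq_norm_sq, real_inner_self_eq_norm_sq,
        b.orthonormal.1, one_pow, mul_one] at e
      rw [← e]
      positivity
    refine ⟨Real.sqrt c, Real.sqrt_nonneg c, ?_⟩
    rw [Real.sq_sqrt h0, neg_smul, ← hSb, hSA, neg_neg]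
  have hker (v : V) (h : A (A v) = 0) : A v = 0 := by
    rw [← inner_self_eq_zero (𝕜 := ℝ), hA, h, inner_zero_right, neg_zero]
  have hJJ : J ∘ₗ J = -LinearMap.id := by
    refine b.toBasis.ext fun i ↦ ?_
    obtain ⟨a, ha, hv⟩ := hb i
    rw [OrthonormalBasis.coe_toBasis]
    change J (J (b i)) = -b i
    rcases ha.eq_or_lt with rfl | ha
    · have hv' : A (b i) = 0 := hker _ (by simpa using hv)
      have hk : (P (b i) : V) = b i := congrArg Subtype.val (hPK ⟨b i, hv'⟩)
      rw [hJK _ hv', hJK _ (j (P (b i))).2, hPK, hj]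
      simp [hk]
    · have h1 := hJA a ha _ hv
      have h2 := hJA a ha (A (b i)) (by rw [hv, map_smul])
      rw [← h1, map_smul, map_smul] at h2
      have h3 : a • a • J (J (b i)) = -(a ^ 2) • b i := by
        rw [h2, ← map_smul, h1, hv]
      have h4 : a ^ 2 • (J (J (b i)) + b i) = 0 := by
        rw [smul_add, pow_two, ← smul_smul, h3]
        module
      exact eq_neg_of_add_eq_zero_left ((smul_eq_zero.1 h4).resolve_left (by positivity))
  refine ⟨J, b.toBasis, fun v ↦ LinearMap.congr_fun hJJ v, fun u v ↦ ?_, fun v hv ↦ ?_, hJA,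
    fun i ↦ by simpa using hb i, fun T hTA hT0 hT v ↦ ?_⟩
  · have e1 : inner ℝ (j (P u) : V) v = -inner ℝ u (j (P v) : V) := by
      rw [real_inner_comm, hP, hP, real_inner_comm, hjs]
    rw [hJ, hJ, inner_add_left, inner_add_right, hA, hRs, e1, hRA, neg_add]
  · rw [hJK v hv]
    exact (j (P v)).2
  -- The kernel part contributes nothing on either side: `P ∘ T = 0`, and `T` kills the values of
  -- `j`.
  · rw [hJ, hJ, hP0 T hT0 hT, map_zero, map_add, hT0 _ (j (P v)).2, hTA, hRT T hTA]
    rfl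

end SkewMaps

/-! ### Samelson's construction on the Lie algebra -/

section SamelsonAlgebra

open Module

/-- `exists_complex_of_skew` for an inner product given by a bilinear form. -/
theorem exists_complex_of_skew_bilin {V : Type*} [AddCommGroup V] [Module ℝ V]
    [FiniteDimensional ℝ V] (hev : Even (finrank ℝ V)) (B : V →ₗ[ℝ] V →ₗ[ℝ] ℝ)
    (hsymm : ∀ u v, B u v = B v u) (hpos : ∀ v, v ≠ 0 → 0 < B v v) {A : V →ₗ[ℝ] V}
    (hA : ∀ u v, B (A u) v = -B u (A v)) :
    ∃ (J : V →ₗ[ℝ] V) (b : Basis (Fin (finrank ℝ V)) ℝ V), (∀ v, J (J v) = -v) ∧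
      (∀ u v, B (J u) v = -B u (J v)) ∧ (∀ v, A v = 0 → A (J v) = 0) ∧
      (∀ a : ℝ, 0 < a → ∀ v, A (A v) = -(a ^ 2) • v → a • J v = A v) ∧
      (∀ i, ∃ a : ℝ, 0 ≤ a ∧ A (A (b i)) = -(a ^ 2) • b i) ∧
      (∀ T : V →ₗ[ℝ] V, (∀ v, T (A v) = A (T v)) → (∀ v, A v = 0 → T v = 0) →
        (∀ u v, B (T u) v = -B u (T v)) → ∀ v, J (T v) = T (J v)) := by
  let core := innerCoreOfBilin B hsymm hpos
  let _ : NormedAddCommGroup V := core.toNormedAddCommGroup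
  let _ : InnerProductSpace ℝ V := InnerProductSpace.ofCore core.toCore
  exact exists_complex_of_skew hev hA

variable {L : Type*} [LieRing L] [LieAlgebra ℝ L]

/-- `B (A v) (A v) = -B v (A (A v))`, so `A` and `A²` have the same kernel, and powers reduce one at
a time. -/
theorem pow_apply_eq_zero_of_skew {V : Type*} [AddCommGroup V] [Module ℝ V]
    (B : V →ₗ[ℝ] V →ₗ[ℝ] ℝ) (hpos : ∀ v, v ≠ 0 → 0 < B v v) {A : V →ₗ[ℝ] V}
    (hA : ∀ u v, B (A u) v = -B u (A v)) (k : ℕ) (v : V) (h : (A ^ k) v = 0) : A v = 0 := by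
  have hker (v : V) (h : A (A v) = 0) : A v = 0 := by
    by_contra h0
    have := hpos _ h0
    rw [hA, h, map_zero, neg_zero] at this
    exact this.false
  induction k with
  | zero =>
    have : v = 0 := h
    rw [this, map_zero]
  | succ k ih =>
    rcases k with _ | k
    · simpa using h
    · refine ih ?_
      rw [pow_succ'] at h ⊢
      rw [pow_succ'] at h
      exact hker _ h

/-- A finite-dimensional real Lie algebra with an invariant inner product contains an element whose
centralizer is abelian. -/
theorem exists_abelian_centralizer [FiniteDimensional ℝ L] (B : L →ₗ[ℝ] L →ₗ[ℝ] ℝ)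
    (hpos : ∀ v, v ≠ 0 → 0 < B v v) (hB : ∀ u v w : L, B ⁅u, v⁆ w = -B v ⁅u, w⁆) :
    ∃ h : L, ∀ x y : L, ⁅h, x⁆ = 0 → ⁅h, y⁆ = 0 → ⁅x, y⁆ = 0 := by
  -- The Engel subalgebra of this `h` is nilpotent and contains the centralizer of `h`. Thus a power
  -- of `ad x` kills `y`, and by skewness `ad x` already does.
  obtain ⟨h, hC⟩ := LieAlgebra.exists_isCartanSubalgebra_engel ℝ L
  refine ⟨h, fun x y hx hy ↦ ?_⟩
  have hmem {x : L} (hx : ⁅h, x⁆ = 0) : x ∈ LieSubalgebra.engel ℝ h := by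
    rw [LieSubalgebra.mem_engel_iff]
    exact ⟨1, by simpa using hx⟩
  have hnil := hC.nilpotent
  obtain ⟨k, hk⟩ := LieModule.exists_forall_pow_toEnd_eq_zero ℝ (LieSubalgebra.engel ℝ h)
    (LieSubalgebra.engel ℝ h)
  have h1 := LinearMap.congr_fun (hk ⟨x, hmem hx⟩) ⟨y, hmem hy⟩
  have h2 (j : ℕ) : (((LieModule.toEnd ℝ (LieSubalgebra.engel ℝ h) (LieSubalgebra.engel ℝ h)
      ⟨x, hmem hx⟩) ^ j) ⟨y, hmem hy⟩ : L) = ((LieAlgebra.ad ℝ L x) ^ j) y := by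
    induction j with
    | zero => rfl
    | succ j ih =>
      rw [pow_succ', pow_succ', Module.End.mul_apply, Module.End.mul_apply, ← ih]
      rfl
  refine pow_apply_eq_zero_of_skew B hpos (A := LieAlgebra.ad ℝ L x) (fun u v ↦ hB x u v) k y ?_
  rw [← h2, h1]
  rfl

/-- Samelson's construction of an integrable complex structure on the Lie algebra of an
even-dimensional compact Lie group. -/
theorem exists_samelson [FiniteDimensional ℝ L] (hev : Even (finrank ℝ L))
    (B : L →ₗ[ℝ] L →ₗ[ℝ] ℝ) (hsymm : ∀ u v, B u v = B v u) (hpos : ∀ v, v ≠ 0 → 0 < B v v)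
    (hB : ∀ u v w : L, B ⁅u, v⁆ w = -B v ⁅u, w⁆) :
    ∃ (J : L →ₗ[ℝ] L) (t : LieSubalgebra ℝ L), (∀ v, J (J v) = -v) ∧
      (∀ u v : L, ⁅J u, J v⁆ - J ⁅J u, v⁆ - J ⁅u, J v⁆ - ⁅u, v⁆ = 0) ∧
      (∀ u v, B (J u) (J v) = B u v) ∧ IsLieAbelian t ∧
      (∀ t' : LieSubalgebra ℝ L, IsLieAbelian t' → t ≤ t' → t' = t) ∧
      ∀ h ∈ t, ∀ v : L, J ⁅h, v⁆ = ⁅h, J v⁆ := by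
  obtain ⟨h, hab⟩ := exists_abelian_centralizer B hpos hB
  obtain ⟨J, b, hJJ, hJs, hJ0, hJA, hb, hJT⟩ := exists_complex_of_skew_bilin hev B hsymm hpos
    (A := LieAlgebra.ad ℝ L h) (fun u v ↦ hB h u v)
  simp only [LieAlgebra.ad_apply] at hJ0 hJA hb hJT
  have hker (v : L) (hv : ⁅h, ⁅h, v⁆⁆ = 0) : ⁅h, v⁆ = 0 :=
    pow_apply_eq_zero_of_skew B hpos (A := LieAlgebra.ad ℝ L h) (fun u v ↦ hB h u v) 2 v
      (by rw [pow_two]; exact hv)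
  have hcomm (x : L) (hx : ⁅h, x⁆ = 0) (v : L) : J ⁅x, v⁆ = ⁅x, J v⁆ := by
    refine hJT (LieAlgebra.ad ℝ L x) (fun v ↦ ?_) (fun v hv ↦ hab x v hx hv)
      (fun u v ↦ hB x u v) v
    rw [LieAlgebra.ad_apply, LieAlgebra.ad_apply, leibniz_lie h, hx, zero_lie, zero_add]
  let t : LieSubalgebra ℝ L :=
    { LinearMap.ker (LieAlgebra.ad ℝ L h) with
      lie_mem' := fun {x y} hx hy ↦ by
        change ⁅h, ⁅x, y⁆⁆ = 0
        rw [hab x y hx hy, lie_zero] }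
  have hmem (x : L) : x ∈ t ↔ ⁅h, x⁆ = 0 := Iff.rfl
  -- The Nijenhuis expression is bilinear, so it suffices to test it on the eigenbasis `b` of `(ad
  -- h)²`. If one argument lies in `t`, then `J` commutes with the brackets involved and the terms
  -- cancel.
  let N : L →ₗ[ℝ] L →ₗ[ℝ] L := LinearMap.mk₂ ℝ
    (fun u v ↦ ⁅J u, J v⁆ - J ⁅J u, v⁆ - J ⁅u, J v⁆ - ⁅u, v⁆)
    (fun u u' v ↦ by simp only [map_add, add_lie]; abel)
    (fun c u v ↦ by simp only [map_smul, smul_lie, smul_sub])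
    (fun u v v' ↦ by simp only [map_add, lie_add]; abel)
    (fun c u v ↦ by simp only [map_smul, lie_smul, smul_sub])
  have hN (u v : L) : N u v = ⁅J u, J v⁆ - J ⁅J u, v⁆ - J ⁅u, J v⁆ - ⁅u, v⁆ := rfl
  have hNskew (u v : L) : N u v = -N v u := by
    rw [hN, hN, ← lie_skew (J u), ← lie_skew (J u) v, ← lie_skew u, ← lie_skew u v, map_neg, map_neg]
    abel
  have hN0 (x v : L) (hx : ⁅h, x⁆ = 0) : N x v = 0 := by
    rw [hN, hcomm _ (hJ0 x hx), hcomm x hx, hJJ, lie_neg]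
    abel
  have hNb : N = 0 := by
    refine LinearMap.ext_basis b b fun i j ↦ ?_
    obtain ⟨a, ha, hi⟩ := hb i
    obtain ⟨c, hc, hj⟩ := hb j
    change N (b i) (b j) = 0
    rcases ha.eq_or_lt with rfl | ha
    · exact hN0 _ _ (hker _ (by simpa using hi))
    rcases hc.eq_or_lt with rfl | hc
    · rw [hNskew, hN0 _ _ (hker _ (by simpa using hj)), neg_zero]
    generalize b i = x at *
    generalize b j = y at *
    have hx := hJA a ha x hi
    have hy := hJA c hc y hj
    have hJx : ⁅h, J x⁆ = -(a • x) := by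
      have : a • ⁅h, J x⁆ = a • -(a • x) := by
        rw [← lie_smul, hx, hi]
        module
      exact smul_right_injective L ha.ne' this
    have hJy : ⁅h, J y⁆ = -(c • y) := by
      have : c • ⁅h, J y⁆ = c • -(c • y) := by
        rw [← lie_smul, hy, hj]
        module
      exact smul_right_injective L hc.ne' this
    -- `P - iQ` is the bracket of `x - iJx` and `y - iJy`, on which `ad h` acts by `ia` and `ic`.
    -- Hence `ad h` acts on it by `i(a + c)`.
    set P := ⁅x, y⁆ - ⁅J x, J y⁆ with hP
    set Q := ⁅J x, y⁆ + ⁅x, J y⁆ with hQ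
    have hAP : ⁅h, P⁆ = (a + c) • Q := by
      rw [hP, lie_sub, leibniz_lie h x, leibniz_lie h (J x), hJx, hJy, ← hx, ← hy, hQ]
      simp only [neg_lie, lie_neg, smul_lie, lie_smul]
      module
    have hAQ : ⁅h, Q⁆ = -((a + c) • P) := by
      rw [hQ, lie_add, leibniz_lie h (J x), leibniz_lie h x, hJx, hJy, ← hx, ← hy, hP]
      simp only [neg_lie, lie_neg, smul_lie, lie_smul]
      module
    have hac : 0 < a + c := by positivity
    -- Since `a + c > 0`, `J` is `ad h / (a + c)` on `P`: sums of positive roots are positive.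
    have hJP : J P = Q := by
      have := hJA (a + c) hac P (by rw [hAP, lie_smul, hAQ]; module)
      rw [hAP] at this
      exact smul_right_injective L hac.ne' this
    have hJQ : J Q = -P := by rw [← hJP, hJJ]
    have : N x y = -P - J Q := by
      rw [hN, hP, hQ, map_add]
      abel
    rw [this, hJQ, sub_self]
  refine ⟨J, t, hJJ, fun u v ↦ ?_, fun u v ↦ ?_, ?_, fun t' ht' hle ↦ ?_, fun x hx v ↦ hcomm x hx v⟩
  · rw [← hN, hNb]
    rfl
  · rw [hJs, hJJ, map_neg, neg_neg]
  · exact ⟨fun x y ↦ Subtype.ext (hab x y x.2 y.2)⟩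
  -- An abelian `t'` containing `t` contains `h`, so its elements commute with `h` and lie in `t`.
  · refine le_antisymm (fun x hx ↦ ?_) hle
    have hh : h ∈ t' := hle ((hmem h).2 (lie_self h))
    exact congrArg Subtype.val (ht'.trivial ⟨h, hh⟩ ⟨x, hx⟩)

end SamelsonAlgebra

/-! ### From the Lie algebra back to the group -/

theorem IsBiinvariant.exists_isSamelson (hn : Even n) {g : Metric n G} (hg : IsBiinvariant g) :
    ∃ C : ComplexStructure n G, IsSamelson C ∧ IsHermitian C g := by
  have hev : Even (Module.finrank ℝ (GroupLieAlgebra (𝓡 n) G)) := by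
    have : Module.finrank ℝ (GroupLieAlgebra (𝓡 n) G) = n :=
      finrank_euclideanSpace_fin (𝕜 := ℝ) (n := n)
    rwa [this]
  obtain ⟨J, t, hJJ, hN, hBJ, ht, htmax, hJt⟩ := exists_samelson
    (L := GroupLieAlgebra (𝓡 n) G) hev (algebraForm (metricOne g))
    (fun u v ↦ g.symm 1 u v) (fun v hv ↦ g.pos 1 v hv)
    (fun u v w ↦ lieBr_skew_of_coAd (G := G) (B := metricOne g) hg.metricOne_coAd u v w)
  let J' : EuclideanSpace ℝ (Fin n) →ₗ[ℝ] EuclideanSpace ℝ (Fin n) := J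
  let Jc : EuclideanSpace ℝ (Fin n) →L[ℝ] EuclideanSpace ℝ (Fin n) := LinearMap.toContinuousLinearMap J'
  refine ⟨leftComplex Jc hJJ hN, ⟨isLeftInvariant_leftComplex (J := Jc) hJJ hN, t, ht, htmax,
    fun h hh v ↦ ?_⟩, isHermitian_leftComplex (J := Jc) hJJ hN hg hBJ⟩
  have h₁ := leftComplex_J_one (G := G) (J := Jc) hJJ hN v
  have h₂ := leftComplex_J_one (G := G) (J := Jc) hJJ hN (lieBr G h v)
  exact h₂.trans ((hJt h hh v).trans
    (congrArg (fun w : GroupLieAlgebra (𝓡 n) G ↦ ⁅h, w⁆) h₁.symm))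

end HermitianGeometry

end

theorem mainTheorem5 (n : ℕ) (hn : Even n) (G : Type*) [TopologicalSpace G]
    [ChartedSpace (EuclideanSpace ℝ (Fin n)) G] [Group G] [LieGroup (𝓡 n) ∞ G]
    [CompactSpace G] [T2Space G] :
    (∃ (C : HermitianGeometry.ComplexStructure n G) (g : HermitianGeometry.Metric n G),
      HermitianGeometry.IsStatic C g 0) ∧
    (∃ g : HermitianGeometry.Metric n G, HermitianGeometry.IsBiinvariant g) ∧
    (LieAlgebra.IsSemisimple ℝ (GroupLieAlgebra (𝓡 n) G) →
      ∃ g : HermitianGeometry.Metric n G,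
        HermitianGeometry.IsBiinvariant g ∧ HermitianGeometry.IsInducedByKillingForm g) ∧
    (∀ g : HermitianGeometry.Metric n G, HermitianGeometry.IsBiinvariant g →
      ∃ C : HermitianGeometry.ComplexStructure n G,
        HermitianGeometry.IsSamelson C ∧ HermitianGeometry.IsHermitian C g) ∧
    (∀ (g : HermitianGeometry.Metric n G) (C : HermitianGeometry.ComplexStructure n G),
      HermitianGeometry.IsBiinvariant g → HermitianGeometry.IsLeftInvariant C →
      HermitianGeometry.IsHermitian C g →
        (∃ D : HermitianGeometry.Connection n G, HermitianGeometry.IsBismut C g D) ∧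
        (∀ D : HermitianGeometry.Connection n G, HermitianGeometry.IsBismut C g D →
          HermitianGeometry.VanishesOnLeftInvariant D ∧
          HermitianGeometry.HasClosedTorsion g D ∧
          HermitianGeometry.RicciFormVanishes C g D) ∧
        HermitianGeometry.IsSKT C g ∧
        HermitianGeometry.IsStatic C g 0) := by
  open HermitianGeometry in
  refine ⟨?_, exists_isBiinvariant n G, exists_isInducedByKillingForm,
    fun g hg ↦ hg.exists_isSamelson hn, fun g C hg hC hH ↦ ⟨⟨_, isBismut_flatConnection hg hC⟩,
      fun D hD ↦ ?_, hg.isSKT hC hH, hg.isStatic hC hH⟩⟩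
  · obtain ⟨g, hg⟩ := exists_isBiinvariant n G
    obtain ⟨C, hC, hH⟩ := hg.exists_isSamelson hn
    exact ⟨C, g, hg.isStatic hC.1 hH⟩
  · have hV := hD.vanishesOnLeftInvariant hg hC hH
    exact ⟨hV, hV.hasClosedTorsion hg, fun x e X Y he hX hY ↦ hV.ricciForm_eq_zero he hX hY⟩
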